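/- **Setting.** A labeled graph $(G,\ell)$ is a finite nonempty simple graph $G=(V,E)$ with a map $\ell:V\to\{0,1\}^*$; a distributed language is a set of labeled graphs. Fix $N:\mathbb N\to\mathbb N$ with $n\le N(n)\le \mathrm{poly}(n)$. In an $n$-node network the nodes have pairwise distinct identifiers in $[1,N(n)]$, and every node initially knows $n$, its identifier, its label, and the identifiers of its neighbors. In a CONGEST round every node sends to each of its neighbors a message of $O(\log n)$ bits (possibly different messages to different neighbors); in a BCC (broadcast congested clique) round every node sends one message of $O(\log n)$ bits to all nodes of the network. Every received message comes with the identifier of its sender, and local computation is unrestricted. An algorithm (the same at all nodes) decides a language $\mathcal L$ if, for every labeled graph and every identifier assignment, all nodes accept if and only if $(G,\ell)\in\mathcal L$. A randomized algorithm decides $\mathcal L$ with error at most $\epsilon$ if, for every labeled graph and every identifier assignment, with probability at least $1-\epsilon$ all nodes accept when $(G,\ell)\in\mathcal L$, and with probability at least $1-\epsilon$ at least one node rejects when $(G,\ell)\notin\mathcal L$. The nodes may use shared random coins (so, in particular, private ones). Let $\mathbf{BC}$ (resp. $\mathbf{CB}$) be the class of languages decided by a deterministic algorithm that performs one BCC round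 followed by one CONGEST round (resp. one CONGEST round followed by one BCC round). **The language.** For $n\ge 2$, $x,y\in\{0,1\}^n$ and $i,j\in[n]$ let $P_{2n+1}$ be the path with consecutive nodes $a_1,\dots,a_n,c,b_n,\dots,b_1$, and let $\ell_{x,y,i,j}$ be its labeling $a_1\mapsto i$, $a_n\mapsto x$, $b_n\mapsto y$, $b_1\mapsto j$ (indices written in binary), and $v\mapsto\bot$ (the empty string) for all other nodes $v$. Up to isomorphism of labeled graphs, let $$\texttt{XOR-index-path}=\{(P_{2n+1},\ell_{x,y,i,j}) : n\ge 2,\ x,y\in\{0,1\}^n,\ i,j\in[n],\ x_j\ne y_i\}.$$ **Theorem.** $\texttt{XOR-index-path}\in\mathbf{BC}\smallsetminus\mathbf{CB}$. Moreover, for every $\epsilon<1/5$, no randomized algorithm that performs one CONGEST round followed by one BCC round decides $\texttt{XOR-index-path}$ with error probability at most $\epsilon$. Furthermore, $\mathbf{CB}$ and $\mathbf{BC}$ are incomparable: $\mathbf{BC}\not\subseteq\mathbf{CB}$ and $\mathbf{CB}\not\subseteq\mathbf{BC}$. -/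

import Mathlib

namespace HybridModels

/-- A bit string; used for node labels and for messages. -/
abbrev BitString := List Bool

/-- A finite nonempty labeled graph `(G, ℓ)` with `ℓ : V(G) → {0,1}^*`. -/
structure LabeledGraph where
  V : Type
  fintypeV : Fintype V
  nonemptyV : Nonempty V
  graph : SimpleGraph V
  label : V → BitString

attribute [instance] LabeledGraph.fintypeV LabeledGraph.nonemptyV

/-- The number of nodes. -/
def LabeledGraph.order (X : LabeledGraph) : ℕ := Fintype.card X.V

/-- Admissible identifier assignments: one-to-one maps into `[1, N(n)]`, `n` the number of nodes. -/
def ValidIds (N : ℕ → ℕ) (X : LabeledGraph) (ident : X.V → ℕ) : Prop :=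
  Function.Injective ident ∧ ∀ v, 1 ≤ ident v ∧ ident v ≤ N X.order

/-- What a node knows before the first round: the number of nodes of the network, its identifier,
its label, and the identifiers of its neighbors. -/
structure LocalInput where
  order : ℕ
  ident : ℕ
  label : BitString
  nbrs : Finset ℕ

open Classical in
/-- The initial knowledge of node `v`. -/
noncomputable def LabeledGraph.localInput (X : LabeledGraph) (ident : X.V → ℕ) (v : X.V) :
    LocalInput where
  order := X.order
  ident := ident v
  label := X.label v
  nbrs := (Finset.univ.filter fun u => X.graph.Adj v u).image ident

/-- The messages received by a node in one round, each with the identifier of its sender. -/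
abbrev Inbox := Finset (ℕ × BitString)

/-- The kinds of communication rounds: a broadcast congested clique round or a CONGEST round. -/
inductive RoundKind
  | bcc
  | congest

/-- A distributed decision algorithm, the same at every node. Everything that a node does in a
round is a function of its initial knowledge and of the list of the inboxes of the previous rounds,
in chronological order (the length of this list tells the node the number of the round).
* `broadcast I h` is the message sent to all nodes if the round is a BCC round;
* `send I h k` is the message sent to the neighbor with identifier `k` in a CONGEST round;
* `accept I h` is the decision after the last round. -/
structure Algorithm where
  broadcast : LocalInput → List Inbox → BitString
  send : LocalInput → List Inbox → ℕ → BitString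
  accept : LocalInput → List Inbox → Bool

/-- In `n`-node networks all messages have at most `C (⌊log₂ n⌋ + 1)` bits. -/
def Algorithm.HasBandwidth (A : Algorithm) (C : ℕ) : Prop :=
  ∀ (I : LocalInput) (h : List Inbox),
    (A.broadcast I h).length ≤ C * (Nat.log 2 I.order + 1) ∧
    ∀ k, (A.send I h k).length ≤ C * (Nat.log 2 I.order + 1)

open Classical in
/-- The inbox of node `v` in a round of the given kind, if `h u` is the list of the previous inboxes
of node `u`. In a BCC round `v` receives the message broadcast by every node, in a CONGEST round it
receives the messages that its neighbors send to it. -/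
noncomputable def Algorithm.inbox (A : Algorithm) (X : LabeledGraph) (ident : X.V → ℕ)
    (h : X.V → List Inbox) (v : X.V) : RoundKind → Inbox
  | .bcc => Finset.univ.image fun u => (ident u, A.broadcast (X.localInput ident u) (h u))
  | .congest => (Finset.univ.filter fun u => X.graph.Adj v u).image
      fun u => (ident u, A.send (X.localInput ident u) (h u) (ident v))

/-- The inboxes of all nodes after performing the rounds of the schedule `s`, in this order,
starting from the inboxes `h`. -/
noncomputable def Algorithm.run (A : Algorithm) (X : LabeledGraph) (ident : X.V → ℕ) :
    List RoundKind → (X.V → List Inbox) → X.V → List Inbox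
  | [], h => h
  | r :: s, h => A.run X ident s fun v => h v ++ [A.inbox X ident h v r]

/-- All nodes accept at the end of the execution of `A` with schedule `s`. -/
def Algorithm.AllAccept (A : Algorithm) (s : List RoundKind) (X : LabeledGraph)
    (ident : X.V → ℕ) : Prop :=
  ∀ v, A.accept (X.localInput ident v) (A.run X ident s (fun _ => []) v) = true

/-- The class of the distributed languages that can be decided by a (deterministic) algorithm that
performs the rounds of the schedule `s`, with `O(log n)`-bit messages and identifiers in
`[1, N(n)]`. -/
def DecisionClass (N : ℕ → ℕ) (s : List RoundKind) : Set (Set LabeledGraph) :=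
  {L | ∃ (A : Algorithm) (C : ℕ), A.HasBandwidth C ∧
    ∀ (X : LabeledGraph) (ident : X.V → ℕ), ValidIds N X ident →
      (X ∈ L ↔ A.AllAccept s X ident)}

/-- The class of the distributed languages that can be decided with error probability at most `ε` by
a randomized algorithm that performs the rounds of the schedule `s`. The random source `ω` is
visible to all nodes; private coins are the special case in which a node uses only the part of `ω`
that is indexed by its own identifier. -/
def RandomizedDecisionClass (N : ℕ → ℕ) (s : List RoundKind) (ε : ℝ) : Set (Set LabeledGraph) :=
  {L | ∃ (Ω : Type) (_ : MeasurableSpace Ω) (μ : MeasureTheory.Measure Ω)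
      (_ : MeasureTheory.IsProbabilityMeasure μ) (A : Ω → Algorithm) (C : ℕ),
    (∀ ω, (A ω).HasBandwidth C) ∧
    ∀ (X : LabeledGraph) (ident : X.V → ℕ), ValidIds N X ident →
      MeasurableSet {ω | (A ω).AllAccept s X ident} ∧
      (X ∈ L → 1 - ε ≤ μ.real {ω | (A ω).AllAccept s X ident}) ∧
      (X ∉ L → 1 - ε ≤ μ.real {ω | ¬ (A ω).AllAccept s X ident})}

/-- One BCC round followed by one CONGEST round. -/
abbrev scheduleBC : List RoundKind := [.bcc, .congest]

/-- One CONGEST round followed by one BCC round. -/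
abbrev scheduleCB : List RoundKind := [.congest, .bcc]

/-- The label of the `k`-th node of the path `a_1, …, a_n, c, b_n, …, b_1`, for `k = 0, …, 2n`:
`a_1 ↦ i`, `a_n ↦ x`, `b_n ↦ y`, `b_1 ↦ j`, and `⊥` (the empty string) elsewhere. The elements
`0, …, n - 1` of `Fin n` stand for the indices `1, …, n`, which are written in binary. -/
def xorIndexLabel {n : ℕ} (x y : Fin n → Bool) (i j : Fin n) (k : ℕ) : BitString :=
  if k = 0 then Nat.bits (i + 1)
  else if k + 1 = n then List.ofFn x
  else if k = n + 1 then List.ofFn y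
  else if k = 2 * n then Nat.bits (j + 1)
  else []

/-- The distributed language XOR-index-path (closed under isomorphism of labeled graphs). -/
def xorIndexPath : Set LabeledGraph :=
  {X | ∃ (n : ℕ) (x y : Fin n → Bool) (i j : Fin n), 2 ≤ n ∧ x j ≠ y i ∧
    ∃ φ : SimpleGraph.pathGraph (2 * n + 1) ≃g X.graph,
      ∀ k, X.label (φ k) = xorIndexLabel x y i j k}

end HybridModels

/-! ### Counting: decisions that split through short messages err often -/

namespace HybridModels

open Finset

/-! With the BCC round first, the topology and the two short indices can be made public; the center
`c` then receives from its two neighbors the bits of `x` and `y` at these indices.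

With the CONGEST round first, for `n ≥ 3` the holder of `x` hears only unlabeled neighbors before it
broadcasts. Its three messages (two to neighbors, one broadcast) are therefore functions of `x`
alone, and take only polynomially many values; the same holds for `y`. Every node but the holder of
`y` sees `y` only through these messages, and symmetrically for `x`. As acceptance requires all
nodes, it is a conjunction of a predicate of `(x, T y, i, j)` and one of `(S x, y, i, j)`; this is
`SplitsThrough`.

Fix `i, j` and the messages. On the resulting rectangle of pairs `(x, y)` the decision is a product
`a x * b y`, whereas the target is an XOR of two bits. If both bits are balanced, a product
disagrees with XOR on at least a quarter of the rectangle (`rectangle_error_ge`). With polynomially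
many classes, a coordinate is nearly balanced on average (`sum_sum_abs_bias_le`, an exponential
moment bound), so for large `n` the error fraction under uniform inputs is at least `1/5`
(`exists_xorError_sum_ge`). Averaging over the coins extends this to randomized algorithms, and
deterministic ones are the case of error `0`.

For the other non-inclusion, a variant places each index next to the string it reads and asks for
the parity of the bits read (`neighborIndexParity`). One CONGEST round finds each bit and one BCC
round collects them. With the BCC round first, broadcasts cannot combine a string with its index,
and the CONGEST round acts only locally, so acceptance splits again and the same counting applies.
-/

/-- The sign `±1` of a bit. -/
def bitSign (b : Bool) : ℝ := if b then 1 else -1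

/-- The exponential moment of a signed sum of independent bits factors over the coordinates, and a
fixed sign does not change the factor. -/
lemma sum_exp_signed_sum (n : ℕ) (s : Fin n → ℝ) (hs : ∀ j, s j = 1 ∨ s j = -1) (t : ℝ) :
    ∑ x : Fin n → Bool, Real.exp (t * ∑ j, s j * bitSign (x j)) = (2 * Real.cosh t) ^ n := by
  have h1 : ∀ x : Fin n → Bool, Real.exp (t * ∑ j, s j * bitSign (x j)) =
      ∏ j, Real.exp (t * (s j * bitSign (x j))) := by
    intro x
    rw [Finset.mul_sum, Real.exp_sum]
  simp_rw [h1]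
  rw [← Fintype.piFinset_univ,
    ← Finset.prod_univ_sum (fun _ => (univ : Finset Bool))
      (fun j b => Real.exp (t * (s j * bitSign b)))]
  have h2 : ∀ j, ∑ b : Bool, Real.exp (t * (s j * bitSign b)) = 2 * Real.cosh t := by
    intro j
    rw [Fintype.sum_bool, Real.cosh_eq]
    rcases hs j with h | h <;> simp [h, bitSign] <;> ring
  rw [Finset.prod_congr rfl fun j _ => h2 j]
  simp

/-- Choosing `s j` as the sign of the bias of coordinate `j` makes the left side a sum over `K` of
one signed sum. This is at most `t * n` per point, up to an exponential tail that may be summed over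
the whole cube. -/
lemma sum_abs_bias_le {n : ℕ} (K : Finset (Fin n → Bool)) {t : ℝ} (ht : 0 < t) :
    ∑ j, |∑ x ∈ K, bitSign (x j)| ≤
      K.card * (t * n) + 2 ^ n * Real.exp (-(t ^ 2 * n / 2)) / t := by
  set s : Fin n → ℝ := fun j => if 0 ≤ ∑ x ∈ K, bitSign (x j) then 1 else -1 with hsdef
  have hs : ∀ j, s j = 1 ∨ s j = -1 := by
    intro j
    simp only [hsdef]
    split_ifs <;> simp
  have h1 : ∑ j, |∑ x ∈ K, bitSign (x j)| = ∑ x ∈ K, ∑ j, s j * bitSign (x j) := by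
    rw [Finset.sum_comm]
    refine Finset.sum_congr rfl fun j _ => ?_
    rw [← Finset.mul_sum]
    simp only [hsdef]
    split_ifs with h
    · rw [abs_of_nonneg h, one_mul]
    · rw [abs_of_neg (not_le.mp h)]; ring
  -- This is `w + 1 ≤ exp w` at `w = t * z - t ^ 2 * n`, divided by `t`.
  have h2 : ∀ z : ℝ, z ≤ t * n + Real.exp (-(t ^ 2 * n)) / t * Real.exp (t * z) := by
    intro z
    have := Real.add_one_le_exp (t * z - t ^ 2 * n)
    have h3 : Real.exp (t * z - t ^ 2 * n) = Real.exp (-(t ^ 2 * n)) * Real.exp (t * z) := by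
      rw [← Real.exp_add]; ring_nf
    rw [h3] at this
    have h4 : t * z ≤ t * (t * n + Real.exp (-(t ^ 2 * n)) / t * Real.exp (t * z)) := by
      have : t * (t * n + Real.exp (-(t ^ 2 * n)) / t * Real.exp (t * z)) =
        t ^ 2 * n + Real.exp (-(t ^ 2 * n)) * Real.exp (t * z) := by
        field_simp
      rw [this]; linarith
    exact le_of_mul_le_mul_left h4 ht
  rw [h1]
  calc ∑ x ∈ K, ∑ j, s j * bitSign (x j)
      ≤ ∑ x ∈ K, (t * n + Real.exp (-(t ^ 2 * n)) / t *
          Real.exp (t * ∑ j, s j * bitSign (x j))) := Finset.sum_le_sum fun x _ => h2 _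
    _ = K.card * (t * n) + Real.exp (-(t ^ 2 * n)) / t *
          ∑ x ∈ K, Real.exp (t * ∑ j, s j * bitSign (x j)) := by
        rw [Finset.sum_add_distrib, Finset.sum_const, nsmul_eq_mul, ← Finset.mul_sum]
    _ ≤ K.card * (t * n) + Real.exp (-(t ^ 2 * n)) / t *
          ∑ x : Fin n → Bool, Real.exp (t * ∑ j, s j * bitSign (x j)) := by
        gcongr
        exact Finset.subset_univ K
    _ ≤ K.card * (t * n) + Real.exp (-(t ^ 2 * n)) / t * (2 * Real.exp (t ^ 2 / 2)) ^ n := by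
        rw [sum_exp_signed_sum n s hs t]
        have := Real.cosh_le_exp_half_sq t
        have := (Real.cosh_pos t).le
        gcongr
    _ = K.card * (t * n) + 2 ^ n * Real.exp (-(t ^ 2 * n / 2)) / t := by
        rw [mul_pow, ← Real.exp_nat_mul]
        have : Real.exp (-(t ^ 2 * n / 2)) =
            Real.exp (-(t ^ 2 * n)) * Real.exp (n * (t ^ 2 / 2)) := by
          rw [← Real.exp_add]; ring_nf
        rw [this]; ring

lemma sum_card_fiber {n : ℕ} {σ : Type*} [Fintype σ] [DecidableEq σ] (S : (Fin n → Bool) → σ) :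
    ∑ s : σ, ((univ.filter fun x => S x = s).card : ℝ) = 2 ^ n := by
  rw [← Nat.cast_sum, ← Finset.card_eq_sum_card_fiberwise (f := S) (t := univ) (by simp)]
  simp

/-- The total bias of the coordinates over the classes of a map with few values. -/
lemma sum_sum_abs_bias_le {n : ℕ} {σ : Type*} [Fintype σ] [DecidableEq σ]
    (S : (Fin n → Bool) → σ) {t : ℝ} (ht : 0 < t) :
    ∑ s, ∑ j, |∑ x with S x = s, bitSign (x j)| ≤
      2 ^ n * (t * n + Fintype.card σ * Real.exp (-(t ^ 2 * n / 2)) / t) := by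
  refine (Finset.sum_le_sum fun s _ => sum_abs_bias_le _ ht).trans (le_of_eq ?_)
  rw [Finset.sum_add_distrib, ← Finset.sum_mul, sum_card_fiber]
  simp only [sum_const, card_univ, nsmul_eq_mul]
  ring

/-- A sum of signs over a subset of `K` is at most the number of plus signs in `K`, and at least
minus the number of minus signs. -/
lemma abs_sum_indicator_mul_bitSign_le {α : Type*} (K : Finset α) (a : α → ℝ)
    (ha : ∀ x, a x = 0 ∨ a x = 1) (b : α → Bool) :
    |∑ x ∈ K, a x * bitSign (b x)| ≤ (K.card + |∑ x ∈ K, bitSign (b x)|) / 2 := by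
  have hcard : (K.card : ℝ) = ∑ x ∈ K, (1 : ℝ) := by simp
  have h1 : ∑ x ∈ K, a x * bitSign (b x) ≤ (K.card + ∑ x ∈ K, bitSign (b x)) / 2 := by
    rw [hcard, ← Finset.sum_add_distrib, Finset.sum_div]
    refine Finset.sum_le_sum fun x _ => ?_
    rcases ha x with h | h <;> cases b x <;> simp [h, bitSign]
  have h2 : -∑ x ∈ K, a x * bitSign (b x) ≤ (K.card - ∑ x ∈ K, bitSign (b x)) / 2 := by
    rw [hcard, ← Finset.sum_sub_distrib, Finset.sum_div, ← Finset.sum_neg_distrib]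
    refine Finset.sum_le_sum fun x _ => ?_
    rcases ha x with h | h <;> cases b x <;> norm_num [h, bitSign]
  have h3 := le_abs_self (∑ x ∈ K, bitSign (b x))
  have h4 := neg_le_abs (∑ x ∈ K, bitSign (b x))
  rw [abs_le]
  constructor <;> linarith

/-- The number of errors of a product predicate on a rectangle. -/
lemma rectangle_error_ge {α β : Type*} (K : Finset α) (L : Finset β)
    (a : α → ℝ) (ha : ∀ x, a x = 0 ∨ a x = 1) (b : β → ℝ) (hb : ∀ y, b y = 0 ∨ b y = 1)
    (u : α → Bool) (v : β → Bool) :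
    (K.card * L.card : ℝ) / 4 - |∑ x ∈ K, bitSign (u x)| * L.card
        - |∑ y ∈ L, bitSign (v y)| * K.card ≤
      ∑ x ∈ K, ∑ y ∈ L, if u x ≠ v y then 1 - a x * b y else a x * b y := by
  set d := ∑ x ∈ K, bitSign (u x) with hd
  set f := ∑ y ∈ L, bitSign (v y) with hf
  -- The XOR indicator is `(1 - σ τ) / 2` for the two signs `σ`, `τ`, so the error indicator is `(1
  -- - σ τ) / 2 + a b σ τ`, which separates into products of sums.
  have h1 : ∑ x ∈ K, ∑ y ∈ L, (if u x ≠ v y then 1 - a x * b y else a x * b y) =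
      ((K.card * L.card : ℝ) - d * f) / 2 +
        (∑ x ∈ K, a x * bitSign (u x)) * ∑ y ∈ L, b y * bitSign (v y) := by
    have : (K.card * L.card : ℝ) = ∑ x ∈ K, ∑ y ∈ L, (1 : ℝ) := by simp
    rw [this, hd, hf, Finset.sum_mul_sum, Finset.sum_mul_sum, ← Finset.sum_sub_distrib,
      Finset.sum_div, ← Finset.sum_add_distrib]
    refine Finset.sum_congr rfl fun x _ => ?_
    rw [← Finset.sum_sub_distrib, Finset.sum_div, ← Finset.sum_add_distrib]
    refine Finset.sum_congr rfl fun y _ => ?_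
    cases u x <;> cases v y <;> simp [bitSign] <;> ring
  rw [h1]
  have hp := abs_sum_indicator_mul_bitSign_le K a ha u
  have hq := abs_sum_indicator_mul_bitSign_le L b hb v
  rw [← hd] at hp
  rw [← hf] at hq
  set p := ∑ x ∈ K, a x * bitSign (u x)
  set q := ∑ y ∈ L, b y * bitSign (v y)
  have hpq : |p * q| ≤ (K.card + |d|) / 2 * ((L.card + |f|) / 2) := by
    rw [abs_mul]; gcongr
  have hdf : |d * f| = |d| * |f| := abs_mul d f
  have hdK : |d| ≤ K.card := by
    refine (Finset.abs_sum_le_sum_abs _ _).trans (le_of_eq ?_)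
    have : ∀ x, |bitSign (u x)| = 1 := fun x => by cases u x <;> simp [bitSign]
    simp [this]
  have h2 := neg_abs_le (p * q)
  have h3 := le_abs_self (d * f)
  have h4 : |d| * |f| ≤ K.card * |f| := by gcongr
  have h5 : 0 ≤ |d| * (L.card : ℝ) := by positivity
  have h6 : 0 ≤ |f| * (K.card : ℝ) := by positivity
  nlinarith

open Classical in
/-- The indicator of the event that the decision `acc` about `x j ≠ y i` is wrong. -/
noncomputable def xorError {n : ℕ} (acc : (Fin n → Bool) → (Fin n → Bool) → Fin n → Fin n → Prop)
    (x y : Fin n → Bool) (i j : Fin n) : ℝ :=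
  if (x j ≠ y i ↔ acc x y i j) then 0 else 1

/-- `acc` is the conjunction of a predicate that depends on `y` only through `T y`
and a predicate that depends on `x` only through `S x`. -/
def SplitsThrough {n : ℕ} {σ τ : Type*} (S : (Fin n → Bool) → σ) (T : (Fin n → Bool) → τ)
    (acc : (Fin n → Bool) → (Fin n → Bool) → Fin n → Fin n → Prop) : Prop :=
  ∃ A B : (Fin n → Bool) → (Fin n → Bool) → Fin n → Fin n → Prop,
    (∀ x y i j, acc x y i j ↔ A x y i j ∧ B x y i j) ∧
    (∀ x y y' i j, T y = T y' → (A x y i j ↔ A x y' i j)) ∧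
    (∀ x x' y i j, S x = S x' → (B x y i j ↔ B x' y i j))

lemma sum_fiberwise_pair {α β σ τ : Type*} [Fintype α] [Fintype β] [Fintype σ] [Fintype τ]
    [DecidableEq σ] [DecidableEq τ] (S : α → σ) (T : β → τ) (f : α → β → ℝ) :
    ∑ x, ∑ y, f x y = ∑ s, ∑ t, ∑ x with S x = s, ∑ y with T y = t, f x y := by
  rw [← Finset.sum_fiberwise univ S fun x => ∑ y, f x y]
  refine Finset.sum_congr rfl fun s _ => ?_
  exact (Finset.sum_congr rfl fun x _ => (Finset.sum_fiberwise univ T (f x)).symm).trans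
    Finset.sum_comm

lemma sum_rectangle_bound {σ τ : Type*} [Fintype σ] [Fintype τ] (n : ℕ) (k : σ → ℝ) (l : τ → ℝ)
    (d : σ → Fin n → ℝ) (f : τ → Fin n → ℝ) :
    ∑ i : Fin n, ∑ j : Fin n, ∑ s, ∑ t, (k s * l t / 4 - d s j * l t - f t i * k s) =
      n * n * ((∑ s, k s) * ∑ t, l t) / 4 - n * ((∑ s, ∑ j, d s j) * ∑ t, l t)
        - n * ((∑ t, ∑ i, f t i) * ∑ s, k s) := by
  have h : ∀ i j : Fin n, ∑ s, ∑ t, (k s * l t / 4 - d s j * l t - f t i * k s) =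
      (∑ s, k s) * (∑ t, l t) / 4 - (∑ s, d s j) * (∑ t, l t) - (∑ t, f t i) * ∑ s, k s := by
    intro i j
    simp_rw [Finset.sum_sub_distrib, ← Finset.sum_div, ← Finset.mul_sum, ← Finset.sum_mul]
    rw [← Finset.mul_sum]
  simp_rw [h, Finset.sum_sub_distrib, ← Finset.sum_mul]
  rw [Finset.sum_comm (s := univ (α := σ)), Finset.sum_comm (s := univ (α := τ))]
  simp only [sum_const, card_univ, Fintype.card_fin, nsmul_eq_mul, ← Finset.mul_sum]
  ring

/-- Each pair of classes is a rectangle on which the decision is a product. The bias terms of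
`rectangle_error_ge` are summed over one index by `Δ`, and the other index contributes a factor `n`.
-/
lemma xorError_sum_ge {n : ℕ} {σ τ : Type*} [Fintype σ] [DecidableEq σ] [Fintype τ]
    [DecidableEq τ] {S : (Fin n → Bool) → σ} {T : (Fin n → Bool) → τ}
    {acc : (Fin n → Bool) → (Fin n → Bool) → Fin n → Fin n → Prop}
    (h : SplitsThrough S T acc) {Δ : ℝ}
    (hS : ∑ s, ∑ j, |∑ x with S x = s, bitSign (x j)| ≤ Δ)
    (hT : ∑ t, ∑ i, |∑ y with T y = t, bitSign (y i)| ≤ Δ) :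
    (n * n * 2 ^ n * 2 ^ n : ℝ) / 4 - 2 * (n * 2 ^ n * Δ) ≤
      ∑ i, ∑ j, ∑ x, ∑ y, xorError acc x y i j := by
  classical
  obtain ⟨A, B, hAB, hA, hB⟩ := h
  have key : ∀ i j s t,
      (((univ.filter fun x => S x = s).card * (univ.filter fun y => T y = t).card : ℝ)) / 4
        - |∑ x with S x = s, bitSign (x j)| * (univ.filter fun y => T y = t).card
        - |∑ y with T y = t, bitSign (y i)| * (univ.filter fun x => S x = s).card ≤
      ∑ x with S x = s, ∑ y with T y = t, xorError acc x y i j := by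
    intro i j s t
    -- Quantifying over the class removes the other variable; inside the rectangle the choice of
    -- representative is immaterial.
    set a : (Fin n → Bool) → ℝ := fun x => if ∃ y, T y = t ∧ A x y i j then 1 else 0 with hadef
    set b : (Fin n → Bool) → ℝ := fun y => if ∃ x, S x = s ∧ B x y i j then 1 else 0 with hbdef
    have ha : ∀ x, a x = 0 ∨ a x = 1 := fun x => by simp only [hadef]; split_ifs <;> simp
    have hb : ∀ x, b x = 0 ∨ b x = 1 := fun x => by simp only [hbdef]; split_ifs <;> simp
    refine (rectangle_error_ge _ _ a ha b hb (fun x => x j) (fun y => y i)).trans (le_of_eq ?_)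
    refine Finset.sum_congr rfl fun x hx => Finset.sum_congr rfl fun y hy => ?_
    simp only [mem_filter, mem_univ, true_and] at hx hy
    have e1 : (∃ y, T y = t ∧ A x y i j) ↔ A x y i j :=
      ⟨fun ⟨y', h1, h2⟩ => (hA x y y' i j (hy.trans h1.symm)).mpr h2, fun h => ⟨y, hy, h⟩⟩
    have e2 : (∃ x, S x = s ∧ B x y i j) ↔ B x y i j :=
      ⟨fun ⟨x', h1, h2⟩ => (hB x x' y i j (hx.trans h1.symm)).mpr h2, fun h => ⟨x, hx, h⟩⟩
    simp only [hadef, hbdef, e1, e2, xorError, hAB]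
    by_cases h1 : A x y i j <;> by_cases h2 : B x y i j <;> by_cases h3 : x j = y i <;>
      simp [h1, h2, h3]
  calc (n * n * 2 ^ n * 2 ^ n : ℝ) / 4 - 2 * (n * 2 ^ n * Δ)
      ≤ (n * n * 2 ^ n * 2 ^ n : ℝ) / 4
        - n * ((∑ s, ∑ j, |∑ x with S x = s, bitSign (x j)|) * 2 ^ n)
        - n * ((∑ t, ∑ i, |∑ y with T y = t, bitSign (y i)|) * 2 ^ n) := by
        have h1 : (n : ℝ) * ((∑ s, ∑ j, |∑ x with S x = s, bitSign (x j)|) * 2 ^ n) ≤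
          n * (Δ * 2 ^ n) := by gcongr
        have h2 : (n : ℝ) * ((∑ t, ∑ i, |∑ y with T y = t, bitSign (y i)|) * 2 ^ n) ≤
          n * (Δ * 2 ^ n) := by gcongr
        linarith
    _ = ∑ i : Fin n, ∑ j : Fin n, ∑ s, ∑ t,
        ((((univ.filter fun x => S x = s).card * (univ.filter fun y => T y = t).card : ℝ)) / 4
        - |∑ x with S x = s, bitSign (x j)| * (univ.filter fun y => T y = t).card
        - |∑ y with T y = t, bitSign (y i)| * (univ.filter fun x => S x = s).card) := by
        rw [sum_rectangle_bound n (fun s => ((univ.filter fun x => S x = s).card : ℝ))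
          (fun t => ((univ.filter fun y => T y = t).card : ℝ))
          (fun s j => |∑ x with S x = s, bitSign (x j)|)
          (fun t i => |∑ y with T y = t, bitSign (y i)|), sum_card_fiber, sum_card_fiber]
        ring
    _ ≤ ∑ i, ∑ j, ∑ s, ∑ t, ∑ x with S x = s, ∑ y with T y = t, xorError acc x y i j :=
        Finset.sum_le_sum fun i _ => Finset.sum_le_sum fun j _ => Finset.sum_le_sum fun s _ =>
          Finset.sum_le_sum fun t _ => key i j s t
    _ = ∑ i, ∑ j, ∑ x, ∑ y, xorError acc x y i j := by
        simp_rw [← sum_fiberwise_pair S T]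

/-- Fixed-length code of the bit strings of length at most `L`. -/
def padCode (L : ℕ) (l : BitString) : Fin L → Option Bool := fun k => l[k.val]?

/-- The symbol `none` marks positions past the end, so the code also records the length. -/
lemma padCode_injOn {L : ℕ} {l l' : BitString} (h : l.length ≤ L) (h' : l'.length ≤ L)
    (e : padCode L l = padCode L l') : l = l' := by
  apply List.ext_getElem?
  intro k
  by_cases hk : k < L
  · exact congrFun e ⟨k, hk⟩
  · rw [List.getElem?_eq_none (by omega), List.getElem?_eq_none (by omega)]

lemma tendsto_bias_bound (C : ℕ) :
    Filter.Tendsto (fun n : ℕ => (27 : ℝ) ^ (C * (Nat.log 2 (2 * n + 1) + 1)) *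
      Real.exp (-((1 / 80 : ℝ) ^ 2 * n / 2))) Filter.atTop (nhds 0) := by
  have h1 : Filter.Tendsto (fun n : ℕ => (6 : ℝ) ^ (5 * C) *
      ((n : ℝ) ^ (5 * C) * Real.exp (-((1 / 12800 : ℝ) * n)))) Filter.atTop (nhds 0) := by
    have h := (Real.tendsto_pow_mul_exp_neg_atTop_nhds_zero (5 * C)).comp
      (tendsto_natCast_atTop_atTop (R := ℝ) |>.const_mul_atTop (r := (1 / 12800 : ℝ)) (by norm_num))
    have h' := h.const_mul ((6 : ℝ) ^ (5 * C) * 12800 ^ (5 * C))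
    rw [mul_zero] at h'
    refine h'.congr fun n => ?_
    simp only [Function.comp]
    rw [mul_pow, div_pow]
    field_simp
    ring_nf
  refine squeeze_zero' (Filter.Eventually.of_forall fun n => by positivity) ?_ h1
  filter_upwards [Filter.eventually_ge_atTop 1] with n hn
  have h2 : (2 : ℝ) ^ (Nat.log 2 (2 * n + 1) + 1) ≤ 6 * n := by
    have : 2 ^ Nat.log 2 (2 * n + 1) ≤ 2 * n + 1 := Nat.pow_log_le_self 2 (by omega)
    have h3 : 2 ^ (Nat.log 2 (2 * n + 1) + 1) ≤ 6 * n := by rw [pow_succ]; omega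
    exact_mod_cast h3
  -- Since `27 ≤ 2 ^ 5`, the number of message classes is polynomial in `n`.
  have h4 : (27 : ℝ) ^ (C * (Nat.log 2 (2 * n + 1) + 1)) ≤ (6 * n) ^ (5 * C) := by
    calc (27 : ℝ) ^ (C * (Nat.log 2 (2 * n + 1) + 1))
        ≤ (2 ^ 5) ^ (C * (Nat.log 2 (2 * n + 1) + 1)) := by gcongr; norm_num
      _ = (2 ^ (Nat.log 2 (2 * n + 1) + 1)) ^ (5 * C) := by
          rw [← pow_mul, ← pow_mul]; congr 1; ring
      _ ≤ (6 * n) ^ (5 * C) := by gcongr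
  calc _ ≤ (6 * n : ℝ) ^ (5 * C) * Real.exp (-((1 / 80 : ℝ) ^ 2 * n / 2)) := by gcongr
    _ = _ := by
      rw [mul_pow, mul_assoc]
      congr 4
      ring

/-- For large `n`, a decision about `x j ≠ y i` that splits through messages of `O(log n)` bits
is wrong on at least one fifth of the inputs. -/
theorem exists_xorError_sum_ge (C : ℕ) : ∃ n : ℕ, 3 ≤ n ∧
    ∀ (S T : (Fin n → Bool) → Fin 3 → BitString)
      (acc : (Fin n → Bool) → (Fin n → Bool) → Fin n → Fin n → Prop),
      (∀ x k, (S x k).length ≤ C * (Nat.log 2 (2 * n + 1) + 1)) →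
      (∀ y k, (T y k).length ≤ C * (Nat.log 2 (2 * n + 1) + 1)) →
      SplitsThrough S T acc →
      (n * n * 2 ^ n * 2 ^ n : ℝ) / 5 ≤ ∑ i, ∑ j, ∑ x, ∑ y, xorError acc x y i j := by
  -- At `t = 1 / 80` the tail is divided by `t`, so it becomes less than `80 / 6400 = 1 / 80 ≤ n /
  -- 80`. With `t * n = n / 80` this gives total bias `n / 40`, and `1 / 4 - 2 / 40 = 1 / 5`.
  have hev := ((tendsto_bias_bound C).eventually_lt_const (by norm_num : (0 : ℝ) < 1 / 6400)).and
    (Filter.eventually_ge_atTop 3)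
  obtain ⟨n, hn, h3⟩ := hev.exists
  refine ⟨n, h3, fun S T acc hS hT hacc => ?_⟩
  set L := C * (Nat.log 2 (2 * n + 1) + 1) with hL
  have hsplit : SplitsThrough (fun x k => padCode L (S x k)) (fun y k => padCode L (T y k)) acc := by
    obtain ⟨A, B, h1, h2, h3⟩ := hacc
    refine ⟨A, B, h1, fun x y y' i j e => h2 x y y' i j ?_, fun x x' y i j e => h3 x x' y i j ?_⟩
    · exact funext fun k => padCode_injOn (hT _ _) (hT _ _) (congrFun e k)
    · exact funext fun k => padCode_injOn (hS _ _) (hS _ _) (congrFun e k)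
  have hn1 : (1 : ℝ) ≤ n := by exact_mod_cast (by omega : 1 ≤ n)
  -- Three messages, each coded by `L` symbols from a ternary alphabet.
  have hcard : (Fintype.card (Fin 3 → Fin L → Option Bool) : ℝ) = 27 ^ L := by
    simp only [Fintype.card_fun, Fintype.card_fin, Fintype.card_option, Fintype.card_bool]
    push_cast
    rw [← pow_mul, mul_comm, pow_mul]
    norm_num
  have hΔ : ∀ R : (Fin n → Bool) → Fin 3 → Fin L → Option Bool,
      ∑ s, ∑ j, |∑ x with R x = s, bitSign (x j)| ≤ 2 ^ n * (n / 40) := by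
    intro R
    refine (sum_sum_abs_bias_le R (t := 1 / 80) (by norm_num)).trans ?_
    rw [hcard]
    gcongr
    linarith
  refine le_trans ?_ (xorError_sum_ge hsplit (hΔ _) (hΔ _))
  apply le_of_eq
  ring

end HybridModels

/-! ### Automorphisms of paths, labeled paths and the views of their nodes -/

namespace HybridModels

open Finset SimpleGraph

/-- The reversal of a path graph. -/
def pathGraphRev (m : ℕ) : pathGraph m ≃g pathGraph m where
  toEquiv := Fin.revPerm
  map_rel_iff' := by
    intro u v
    simp only [pathGraph_adj, Fin.revPerm_apply, Fin.val_rev]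
    omega

lemma pathGraphRev_val {m : ℕ} (k : Fin m) : (pathGraphRev m k : ℕ) = m - (k + 1) := by
  simp [pathGraphRev, Fin.val_rev]

/-- By induction the image of `k + 1` is a neighbor of `k`, and by injectivity it is not `k - 1`. -/
lemma pathGraph_iso_eq_self_of_zero {m : ℕ} (φ : pathGraph (m + 1) ≃g pathGraph (m + 1))
    (h0 : φ 0 = 0) (k : Fin (m + 1)) : φ k = k := by
  have key : ∀ k : ℕ, ∀ hk : k < m + 1, (φ ⟨k, hk⟩ : ℕ) = k := by
    intro k
    induction k using Nat.strong_induction_on with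
    | _ k ih =>
      intro hk
      rcases k with _ | k
      · exact congrArg Fin.val h0
      · have hadj : (pathGraph (m + 1)).Adj (φ ⟨k, by omega⟩) (φ ⟨k + 1, hk⟩) := by
          rw [φ.map_adj_iff, pathGraph_adj]; simp
        rw [pathGraph_adj, ih k (by omega) (by omega)] at hadj
        rcases hadj with h | h
        · exact h.symm
        · exfalso
          rcases k with _ | k
          · omega
          · have h1 := ih k (by omega) (by omega)
            have h2 : φ ⟨k + 1 + 1, hk⟩ = φ ⟨k, by omega⟩ := Fin.ext (by omega)
            have h3 := congrArg Fin.val (φ.injective h2)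
            simp only at h3
            omega
  exact Fin.ext (key k.val k.isLt)

/-- An interior image would have two neighbors, whose preimages would be two distinct neighbors of
the endpoint `0`. -/
lemma pathGraph_iso_zero {m : ℕ} (φ : pathGraph (m + 1) ≃g pathGraph (m + 1)) :
    φ 0 = 0 ∨ φ 0 = Fin.last m := by
  by_contra hcon
  push Not at hcon
  obtain ⟨h0, h1⟩ := hcon
  have h0' : (φ 0 : ℕ) ≠ 0 := fun h => h0 (Fin.ext h)
  have h1' : (φ 0 : ℕ) ≠ m := fun h => h1 (Fin.ext h)
  have hlt := (φ 0).isLt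
  obtain ⟨u, hu⟩ := φ.surjective ⟨(φ 0 : ℕ) - 1, by omega⟩
  obtain ⟨w, hw⟩ := φ.surjective ⟨(φ 0 : ℕ) + 1, by omega⟩
  have au : (pathGraph (m + 1)).Adj 0 u := by
    rw [← φ.map_adj_iff, hu, pathGraph_adj]; simp; omega
  have aw : (pathGraph (m + 1)).Adj 0 w := by
    rw [← φ.map_adj_iff, hw, pathGraph_adj]; simp
  rw [pathGraph_adj] at au aw
  simp at au aw
  have : u = w := Fin.ext (by omega)
  rw [this, hw] at hu
  have := congrArg Fin.val hu
  simp at this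
  omega

lemma pathGraph_iso_eq {m : ℕ} (φ : pathGraph (m + 1) ≃g pathGraph (m + 1)) :
    (∀ k, φ k = k) ∨ ∀ k, φ (pathGraphRev (m + 1) k) = k := by
  rcases pathGraph_iso_zero φ with h | h
  · exact Or.inl (pathGraph_iso_eq_self_of_zero φ h)
  · right
    have : ∀ k, ((pathGraphRev (m + 1)).trans φ) k = k := by
      rcases pathGraph_iso_zero ((pathGraphRev (m + 1)).trans φ) with h' | h'
      · exact pathGraph_iso_eq_self_of_zero _ h'
      -- Both ends are sent to the last node, so the path has a single node.
      · have h2 : φ (pathGraphRev (m + 1) 0) = φ 0 := by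
          rw [h]; exact h'
        have h3 := congrArg Fin.val (φ.injective h2)
        rw [pathGraphRev_val] at h3
        simp at h3
        subst h3
        intro k
        exact Subsingleton.elim (α := Fin 1) _ _
    exact this

/-- Here `2 ≤ n` keeps the four labeled positions distinct, so the order of the cases is irrelevant.
-/
lemma xorIndexLabel_rev {n : ℕ} (hn : 2 ≤ n) (x y : Fin n → Bool) (i j : Fin n) {k : ℕ}
    (hk : k < 2 * n + 1) :
    xorIndexLabel x y i j (2 * n + 1 - (k + 1)) = xorIndexLabel y x j i k := by
  unfold xorIndexLabel
  split_ifs <;> first | rfl | omega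

lemma xorIndexLabel_zero {n : ℕ} (x y : Fin n → Bool) (i j : Fin n) :
    xorIndexLabel x y i j 0 = Nat.bits (i + 1) := by
  simp [xorIndexLabel]

lemma xorIndexLabel_left {n : ℕ} (hn : 2 ≤ n) (x y : Fin n → Bool) (i j : Fin n) :
    xorIndexLabel x y i j (n - 1) = List.ofFn x := by
  unfold xorIndexLabel
  rw [if_neg (by omega), if_pos (by omega)]

lemma xorIndexLabel_right {n : ℕ} (x y : Fin n → Bool) (i j : Fin n) :
    xorIndexLabel x y i j (n + 1) = List.ofFn y := by
  unfold xorIndexLabel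
  rw [if_neg (by omega), if_neg (by omega), if_pos rfl]

lemma xorIndexLabel_last {n : ℕ} (hn : 2 ≤ n) (x y : Fin n → Bool) (i j : Fin n) :
    xorIndexLabel x y i j (2 * n) = Nat.bits (j + 1) := by
  unfold xorIndexLabel
  rw [if_neg (by omega), if_neg (by omega), if_neg (by omega), if_pos rfl]

lemma xorIndexLabel_other {n : ℕ} (x y : Fin n → Bool) (i j : Fin n) {k : ℕ} (h0 : k ≠ 0)
    (h1 : k + 1 ≠ n) (h2 : k ≠ n + 1) (h3 : k ≠ 2 * n) : xorIndexLabel x y i j k = [] := by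
  unfold xorIndexLabel
  rw [if_neg h0, if_neg h1, if_neg h2, if_neg h3]

lemma natBits_injective : Function.Injective Nat.bits := by
  intro a b h
  have := congrArg (fun l : List Bool => l.foldr Nat.bit 0) h
  have hb : ∀ n : ℕ, n.bits.foldr Nat.bit 0 = n := by
    intro n
    induction n using Nat.binaryRec' with
    | zero => simp
    | bit b n h ih => rw [Nat.bits_append_bit _ _ h]; simp [ih]
  simpa [hb] using this

lemma natBits_succ_inj {n : ℕ} {i j : Fin n} (h : Nat.bits (i + 1) = Nat.bits (j + 1)) : i = j :=
  Fin.ext (by simpa using natBits_injective h)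

/-- `X` is the labeled path of `x, y, i, j`, with the nodes enumerated along the path by `φ`. -/
def IsXorIndexPath (X : LabeledGraph) {n : ℕ} (x y : Fin n → Bool) (i j : Fin n)
    (φ : pathGraph (2 * n + 1) ≃g X.graph) : Prop :=
  ∀ k, X.label (φ k) = xorIndexLabel x y i j k

lemma IsXorIndexPath.rev {X : LabeledGraph} {n : ℕ} (hn : 2 ≤ n) {x y : Fin n → Bool}
    {i j : Fin n} {φ : pathGraph (2 * n + 1) ≃g X.graph} (h : IsXorIndexPath X x y i j φ) :
    IsXorIndexPath X y x j i ((pathGraphRev (2 * n + 1)).trans φ) := by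
  intro k
  have := h (pathGraphRev (2 * n + 1) k)
  rw [pathGraphRev_val, xorIndexLabel_rev hn _ _ _ _ k.isLt] at this
  exact this

/-- Any enumeration along the path can be used to witness membership in the language. -/
lemma exists_isXorIndexPath {X : LabeledGraph} (hX : X ∈ xorIndexPath) {n : ℕ}
    (φ : pathGraph (2 * n + 1) ≃g X.graph) :
    2 ≤ n ∧ ∃ (x y : Fin n → Bool) (i j : Fin n), x j ≠ y i ∧ IsXorIndexPath X x y i j φ := by
  obtain ⟨m, x, y, i, j, hm, hxy, ψ, hψ⟩ := hX
  have hmn : m = n := by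
    have := Fintype.card_congr (ψ.toEquiv.trans φ.toEquiv.symm)
    simp at this
    omega
  subst hmn
  refine ⟨hm, ?_⟩
  -- Two enumerations agree or are reverse to each other; reversal swaps `x` with `y` and `i` with
  -- `j`, which preserves the condition.
  rcases pathGraph_iso_eq (φ.trans ψ.symm) with h | h
  · refine ⟨x, y, i, j, hxy, fun k => ?_⟩
    have h1 : ψ.symm (φ k) = k := h k
    have h2 : φ k = ψ k := by
      have := congrArg ψ h1
      rwa [RelIso.apply_symm_apply] at this
    rw [h2]; exact hψ k
  · refine ⟨y, x, j, i, hxy.symm, fun k => ?_⟩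
    have h1 : ψ.symm (φ (pathGraphRev _ (pathGraphRev _ k))) = pathGraphRev _ k := h _
    have h2 : pathGraphRev (2 * m + 1) (pathGraphRev _ k) = k := by
      apply Fin.ext; rw [pathGraphRev_val, pathGraphRev_val]; omega
    rw [h2] at h1
    have h3 : φ k = ψ (pathGraphRev _ k) := by
      have := congrArg ψ h1
      rwa [RelIso.apply_symm_apply] at this
    rw [h3]
    exact IsXorIndexPath.rev hm hψ k

/-- The path `0, …, 2n` with the labels `ℓ`. -/
def labeledPath (n : ℕ) (ℓ : ℕ → BitString) : LabeledGraph where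
  V := Fin (2 * n + 1)
  fintypeV := inferInstance
  nonemptyV := inferInstance
  graph := pathGraph (2 * n + 1)
  label k := ℓ k

lemma labeledPath_mem_xorIndexPath {n : ℕ} (hn : 2 ≤ n) (x y : Fin n → Bool) (i j : Fin n) :
    labeledPath n (xorIndexLabel x y i j) ∈ xorIndexPath ↔ x j ≠ y i := by
  constructor
  · intro h
    obtain ⟨-, x', y', i', j', hxy, hl⟩ := exists_isXorIndexPath h (n := n) (Iso.refl)
    have hl' : ∀ k, k < 2 * n + 1 → xorIndexLabel x y i j k = xorIndexLabel x' y' i' j' k :=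
      fun k hk => hl ⟨k, hk⟩
    have h0 := hl' 0 (by omega)
    have h1 := hl' (n - 1) (by omega)
    have h2 := hl' (n + 1) (by omega)
    have h3 := hl' (2 * n) (by omega)
    rw [xorIndexLabel_zero, xorIndexLabel_zero] at h0
    rw [xorIndexLabel_left hn, xorIndexLabel_left hn] at h1
    rw [xorIndexLabel_right, xorIndexLabel_right] at h2
    rw [xorIndexLabel_last hn, xorIndexLabel_last hn] at h3
    rwa [natBits_succ_inj h0, natBits_succ_inj h3, List.ofFn_injective h1,
      List.ofFn_injective h2]
  · intro h
    exact ⟨n, x, y, i, j, hn, h, Iso.refl, fun k => rfl⟩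

/-- The identifiers `1, …, 2n + 1` along the path. -/
def pathIdent (n : ℕ) (k : Fin (2 * n + 1)) : ℕ := k + 1

lemma labeledPath_order (n : ℕ) (ℓ : ℕ → BitString) : (labeledPath n ℓ).order = 2 * n + 1 :=
  Fintype.card_fin (2 * n + 1)

lemma validIds_pathIdent {N : ℕ → ℕ} (hN : ∀ n, n ≤ N n) (n : ℕ) (ℓ : ℕ → BitString) :
    ValidIds N (labeledPath n ℓ) (pathIdent n) := by
  refine ⟨fun a b h => ?_, fun v => ?_⟩
  · apply Fin.ext; simpa [pathIdent] using h
  · rw [labeledPath_order]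
    have h1 := hN (2 * n + 1)
    have h2 : pathIdent n v ≤ 2 * n + 1 := by
      have : Fin.val v < 2 * n + 1 := Fin.isLt v
      simp only [pathIdent]; omega
    exact ⟨by simp [pathIdent], by omega⟩

/-- The initial knowledge of a node of a labeled path. -/
noncomputable def pathInput (n : ℕ) (ℓ : ℕ → BitString) (v : Fin (2 * n + 1)) : LocalInput :=
  (labeledPath n ℓ).localInput (pathIdent n) v

lemma pathInput_congr {n : ℕ} {ℓ ℓ' : ℕ → BitString} {v : Fin (2 * n + 1)} (h : ℓ v = ℓ' v) :
    pathInput n ℓ v = pathInput n ℓ' v := by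
  unfold pathInput LabeledGraph.localInput labeledPath
  simp only [h]
  rfl

lemma pathInput_order (n : ℕ) (ℓ : ℕ → BitString) (v : Fin (2 * n + 1)) :
    (pathInput n ℓ v).order = 2 * n + 1 := labeledPath_order n ℓ

/-- The inbox of a node of a labeled path. -/
noncomputable def pathInbox (A : Algorithm) (n : ℕ) (ℓ : ℕ → BitString)
    (h : Fin (2 * n + 1) → List Inbox) (r : RoundKind) (v : Fin (2 * n + 1)) : Inbox :=
  A.inbox (labeledPath n ℓ) (pathIdent n) h v r

lemma pathInbox_congest_congr (A : Algorithm) {n : ℕ} {ℓ ℓ' : ℕ → BitString}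
    {h h' : Fin (2 * n + 1) → List Inbox} {v : Fin (2 * n + 1)}
    (H : ∀ u, (pathGraph (2 * n + 1)).Adj v u →
      A.send (pathInput n ℓ u) (h u) (pathIdent n v) =
        A.send (pathInput n ℓ' u) (h' u) (pathIdent n v)) :
    pathInbox A n ℓ h .congest v = pathInbox A n ℓ' h' .congest v := by
  classical
  ext p
  simp only [pathInbox, Algorithm.inbox, mem_image, mem_filter, mem_univ, true_and]
  constructor
  · rintro ⟨u, hu, rfl⟩
    exact ⟨u, hu, by rw [Prod.mk.injEq]; exact ⟨rfl, (H u hu).symm⟩⟩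
  · rintro ⟨u, hu, rfl⟩
    exact ⟨u, hu, by rw [Prod.mk.injEq]; exact ⟨rfl, (H u hu)⟩⟩

lemma pathInbox_bcc_congr (A : Algorithm) {n : ℕ} {ℓ ℓ' : ℕ → BitString}
    {h h' : Fin (2 * n + 1) → List Inbox} (v : Fin (2 * n + 1))
    (H : ∀ u, A.broadcast (pathInput n ℓ u) (h u) = A.broadcast (pathInput n ℓ' u) (h' u)) :
    pathInbox A n ℓ h .bcc v = pathInbox A n ℓ' h' .bcc v := by
  classical
  ext p
  simp only [pathInbox, Algorithm.inbox, mem_image, mem_univ, true_and]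
  constructor
  · rintro ⟨u, rfl⟩
    exact ⟨u, by rw [Prod.mk.injEq]; exact ⟨rfl, (H u).symm⟩⟩
  · rintro ⟨u, rfl⟩
    exact ⟨u, by rw [Prod.mk.injEq]; exact ⟨rfl, (H u)⟩⟩

/-- The inbox of a node of a labeled path after a first round of the given kind. -/
noncomputable def firstInbox (A : Algorithm) (n : ℕ) (ℓ : ℕ → BitString) (r : RoundKind)
    (v : Fin (2 * n + 1)) : Inbox :=
  pathInbox A n ℓ (fun _ => []) r v

/-- A node of a labeled path accepts after two rounds of the given kinds. -/
def AcceptsAt (A : Algorithm) (n : ℕ) (ℓ : ℕ → BitString) (r r' : RoundKind)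
    (v : Fin (2 * n + 1)) : Prop :=
  A.accept (pathInput n ℓ v)
    [firstInbox A n ℓ r v, pathInbox A n ℓ (fun u => [firstInbox A n ℓ r u]) r' v] = true

lemma allAccept_iff_acceptsAt (A : Algorithm) (n : ℕ) (ℓ : ℕ → BitString) (r r' : RoundKind) :
    A.AllAccept [r, r'] (labeledPath n ℓ) (pathIdent n) ↔ ∀ v, AcceptsAt A n ℓ r r' v :=
  Iff.rfl

/-- After a CONGEST round and a BCC round, the other nodes depend on the label of `d` only through
the messages of `d`. -/
lemma acceptsAt_congest_bcc_congr (A : Algorithm) {n : ℕ} {ℓ ℓ' : ℕ → BitString}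
    {d : Fin (2 * n + 1)} (hl : ∀ v, v ≠ d → ℓ v = ℓ' v)
    (hs : ∀ v, (pathGraph (2 * n + 1)).Adj v d →
      A.send (pathInput n ℓ d) [] (pathIdent n v) = A.send (pathInput n ℓ' d) [] (pathIdent n v))
    (hb : A.broadcast (pathInput n ℓ d) [firstInbox A n ℓ .congest d] =
      A.broadcast (pathInput n ℓ' d) [firstInbox A n ℓ' .congest d])
    {v : Fin (2 * n + 1)} (hv : v ≠ d) :
    AcceptsAt A n ℓ .congest .bcc v ↔ AcceptsAt A n ℓ' .congest .bcc v := by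
  have h1 : ∀ v, firstInbox A n ℓ .congest v = firstInbox A n ℓ' .congest v := by
    intro v
    refine pathInbox_congest_congr A fun u hu => ?_
    by_cases hud : u = d
    · subst hud; exact hs v hu
    · rw [pathInput_congr (hl u hud)]
  have h2 : pathInbox A n ℓ (fun u => [firstInbox A n ℓ .congest u]) .bcc v =
      pathInbox A n ℓ' (fun u => [firstInbox A n ℓ' .congest u]) .bcc v := by
    refine pathInbox_bcc_congr A v fun u => ?_
    by_cases hud : u = d
    · subst hud; exact hb
    · rw [pathInput_congr (hl u hud), h1]
  unfold AcceptsAt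
  rw [h1, h2, pathInput_congr (hl v hv)]

/-- After a BCC round and a CONGEST round, the nodes other than `d` and its neighbors depend on the
label of `d` only through the message broadcast by `d`. -/
lemma acceptsAt_bcc_congest_congr (A : Algorithm) {n : ℕ} {ℓ ℓ' : ℕ → BitString}
    {d : Fin (2 * n + 1)} (hl : ∀ v, v ≠ d → ℓ v = ℓ' v)
    (hb : A.broadcast (pathInput n ℓ d) [] = A.broadcast (pathInput n ℓ' d) [])
    {v : Fin (2 * n + 1)} (hv : v ≠ d) (hvd : ¬ (pathGraph (2 * n + 1)).Adj v d) :
    AcceptsAt A n ℓ .bcc .congest v ↔ AcceptsAt A n ℓ' .bcc .congest v := by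
  have h1 : ∀ v, firstInbox A n ℓ .bcc v = firstInbox A n ℓ' .bcc v := by
    intro v
    refine pathInbox_bcc_congr A v fun u => ?_
    by_cases hud : u = d
    · subst hud; exact hb
    · rw [pathInput_congr (hl u hud)]
  have h2 : pathInbox A n ℓ (fun u => [firstInbox A n ℓ .bcc u]) .congest v =
      pathInbox A n ℓ' (fun u => [firstInbox A n ℓ' .bcc u]) .congest v := by
    refine pathInbox_congest_congr A fun u hu => ?_
    have hud : u ≠ d := by rintro rfl; exact hvd hu
    rw [pathInput_congr (hl u hud), h1]
  unfold AcceptsAt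
  rw [h1, h2, pathInput_congr (hl v hv)]

end HybridModels

/-! ### Averaging over the coins, and the lower bound for CONGEST followed by BCC -/

namespace HybridModels

open Finset SimpleGraph MeasureTheory

/-- The node `k` of the path `0, …, 2n`. -/
def pathNode (n k : ℕ) (h : k < 2 * n + 1) : Fin (2 * n + 1) := ⟨k, h⟩

/-- The easy direction of Yao's principle: each outcome of the coins errs on a fifth of the inputs,
while the expected error on each input is at most `ε`. The bandwidth constant is fixed before `n` is
chosen. -/
lemma not_mem_randomizedDecisionClass {N : ℕ → ℕ} (hN : ∀ n, n ≤ N n) {s : List RoundKind}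
    {L : Set LabeledGraph} {ε : ℝ} (hε : ε < 1 / 5)
    (H : ∀ C : ℕ, ∃ n : ℕ, 3 ≤ n ∧
      ∃ ℓ : (Fin n → Bool) → (Fin n → Bool) → Fin n → Fin n → ℕ → BitString,
      (∀ x y i j, labeledPath n (ℓ x y i j) ∈ L ↔ x j ≠ y i) ∧
      ∀ A : Algorithm, A.HasBandwidth C →
        (n * n * 2 ^ n * 2 ^ n : ℝ) / 5 ≤ ∑ i, ∑ j, ∑ x, ∑ y,
          xorError (fun x y i j => A.AllAccept s (labeledPath n (ℓ x y i j)) (pathIdent n))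
            x y i j) :
    L ∉ RandomizedDecisionClass N s ε := by
  classical
  rintro ⟨Ω, _, μ, _, A, C, hC, hA⟩
  obtain ⟨n, hn, ℓ, hℓ, hE⟩ := H C
  set acc : Ω → (Fin n → Bool) → (Fin n → Bool) → Fin n → Fin n → Prop := fun ω x y i j =>
    (A ω).AllAccept s (labeledPath n (ℓ x y i j)) (pathIdent n) with hacc
  have key : ∀ x y i j, Integrable (fun ω => xorError (acc ω) x y i j) μ ∧
      ∫ ω, xorError (acc ω) x y i j ∂μ ≤ ε := by
    intro x y i j
    obtain ⟨hm, h1, h2⟩ := hA _ _ (validIds_pathIdent hN n (ℓ x y i j))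
    rw [hℓ] at h1 h2
    by_cases hxy : x j ≠ y i
    · have he : (fun ω => xorError (acc ω) x y i j) =
          Set.indicator {ω | acc ω x y i j}ᶜ (fun _ => (1 : ℝ)) := by
        funext ω
        by_cases h : acc ω x y i j <;> simp [xorError, hxy, h]
      rw [he]
      refine ⟨(integrable_const _).indicator hm.compl, ?_⟩
      rw [integral_indicator_const _ hm.compl, probReal_compl_eq_one_sub hm]
      have := h1 hxy
      simp only [smul_eq_mul, mul_one]
      linarith
    · have he : (fun ω => xorError (acc ω) x y i j) =
          Set.indicator {ω | acc ω x y i j} (fun _ => (1 : ℝ)) := by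
        funext ω
        by_cases h : acc ω x y i j <;> simp [xorError, hxy, h]
      rw [he]
      refine ⟨(integrable_const _).indicator hm, ?_⟩
      have h3 := h2 hxy
      have h4 : {ω | ¬ (A ω).AllAccept s (labeledPath n (ℓ x y i j)) (pathIdent n)} =
        {ω | acc ω x y i j}ᶜ := rfl
      rw [h4, probReal_compl_eq_one_sub hm] at h3
      rw [integral_indicator_const _ hm]
      simp only [smul_eq_mul, mul_one]
      linarith
  have hle : (n * n * 2 ^ n * 2 ^ n : ℝ) / 5 ≤ n * n * 2 ^ n * 2 ^ n * ε := by
    calc (n * n * 2 ^ n * 2 ^ n : ℝ) / 5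
        = ∫ _, (n * n * 2 ^ n * 2 ^ n : ℝ) / 5 ∂μ := by simp
      _ ≤ ∫ ω, ∑ i, ∑ j, ∑ x, ∑ y, xorError (acc ω) x y i j ∂μ := by
        refine integral_mono (integrable_const _) ?_ fun ω => hE (A ω) (hC ω)
        exact integrable_finsetSum _ fun i _ => integrable_finsetSum _ fun j _ =>
          integrable_finsetSum _ fun x _ => integrable_finsetSum _ fun y _ => (key x y i j).1
      _ = ∑ i, ∑ j, ∑ x, ∑ y, ∫ ω, xorError (acc ω) x y i j ∂μ := by
        have i1 := fun i j x y => (key x y i j).1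
        have i2 := fun i j x => integrable_finsetSum univ fun y _ => i1 i j x y
        have i3 := fun i j => integrable_finsetSum univ fun x _ => i2 i j x
        have i4 := fun i => integrable_finsetSum univ fun j _ => i3 i j
        rw [integral_finsetSum _ fun i _ => i4 i]
        refine Finset.sum_congr rfl fun i _ => ?_
        rw [integral_finsetSum _ fun j _ => i3 i j]
        refine Finset.sum_congr rfl fun j _ => ?_
        rw [integral_finsetSum _ fun x _ => i2 i j x]
        refine Finset.sum_congr rfl fun x _ => ?_
        rw [integral_finsetSum _ fun y _ => i1 i j x y]
      _ ≤ ∑ i : Fin n, ∑ j : Fin n, ∑ x : Fin n → Bool, ∑ y : Fin n → Bool, ε :=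
        Finset.sum_le_sum fun i _ => Finset.sum_le_sum fun j _ => Finset.sum_le_sum fun x _ =>
          Finset.sum_le_sum fun y _ => (key x y i j).2
      _ = n * n * 2 ^ n * 2 ^ n * ε := by simp; ring
  have hpos : (0 : ℝ) < n * n * 2 ^ n * 2 ^ n := by
    have : (0 : ℝ) < n := by exact_mod_cast (by omega : 0 < n)
    positivity
  have := mul_lt_mul_of_pos_left hε hpos
  linarith

lemma decisionClass_subset_randomizedDecisionClass (N : ℕ → ℕ) (s : List RoundKind) :
    DecisionClass N s ⊆ RandomizedDecisionClass N s 0 := by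
  rintro L ⟨A, C, hC, hA⟩
  refine ⟨Unit, inferInstance, Measure.dirac (), inferInstance, fun _ => A, C, fun _ => hC,
    fun X ident hX => ⟨MeasurableSet.const _, fun h => ?_, fun h => ?_⟩⟩
  · have := (hA X ident hX).mp h
    simp [this]
  · have := (hA X ident hX).not.mp h
    simp [this]

/-- The messages that depend on the label `x` of the node `n - 1`. -/
noncomputable def leftMessages (A : Algorithm) (n : ℕ) (h : 3 ≤ n) (x : Fin n → Bool)
    (k : Fin 3) : BitString :=
  -- The other parameters are dummies that these messages cannot detect. Node `k` has identifier `k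
  -- + 1`, so the neighbors of node `n - 1` have identifiers `n - 1` and `n + 1`.
  let ℓ := xorIndexLabel x (fun _ => false) ⟨0, by omega⟩ ⟨0, by omega⟩
  let d := pathNode n (n - 1) (by omega)
  if k = 0 then A.send (pathInput n ℓ d) [] (n - 1)
  else if k = 1 then A.send (pathInput n ℓ d) [] (n + 1)
  else A.broadcast (pathInput n ℓ d) [firstInbox A n ℓ .congest d]

/-- The messages that depend on the label `y` of the node `n + 1`. -/
noncomputable def rightMessages (A : Algorithm) (n : ℕ) (h : 3 ≤ n) (y : Fin n → Bool)
    (k : Fin 3) : BitString :=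
  let ℓ := xorIndexLabel (fun _ => false) y ⟨0, by omega⟩ ⟨0, by omega⟩
  let d := pathNode n (n + 1) (by omega)
  if k = 0 then A.send (pathInput n ℓ d) [] (n + 1)
  else if k = 1 then A.send (pathInput n ℓ d) [] (n + 3)
  else A.broadcast (pathInput n ℓ d) [firstInbox A n ℓ .congest d]

lemma firstInbox_congest_congr (A : Algorithm) {n : ℕ} {ℓ ℓ' : ℕ → BitString}
    {v : Fin (2 * n + 1)} (H : ∀ u : Fin (2 * n + 1), (u : ℕ) + 1 = v ∨ (v : ℕ) + 1 = u → ℓ u = ℓ' u) :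
    firstInbox A n ℓ .congest v = firstInbox A n ℓ' .congest v := by
  refine pathInbox_congest_congr A fun u hu => ?_
  rw [pathGraph_adj] at hu
  rw [pathInput_congr (H u hu.symm)]

/-- For `3 ≤ n` both neighbors of the holder of `x` have empty labels. -/
lemma firstInbox_left (A : Algorithm) {n : ℕ} (h : 3 ≤ n) (x y x' y' : Fin n → Bool)
    (i j i' j' : Fin n) :
    firstInbox A n (xorIndexLabel x y i j) .congest (pathNode n (n - 1) (by omega)) =
      firstInbox A n (xorIndexLabel x' y' i' j') .congest (pathNode n (n - 1) (by omega)) := by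
  refine firstInbox_congest_congr A fun u hu => ?_
  simp only [pathNode] at hu
  rw [xorIndexLabel_other, xorIndexLabel_other] <;> omega

lemma firstInbox_right (A : Algorithm) {n : ℕ} (h : 3 ≤ n) (x y x' y' : Fin n → Bool)
    (i j i' j' : Fin n) :
    firstInbox A n (xorIndexLabel x y i j) .congest (pathNode n (n + 1) (by omega)) =
      firstInbox A n (xorIndexLabel x' y' i' j') .congest (pathNode n (n + 1) (by omega)) := by
  refine firstInbox_congest_congr A fun u hu => ?_
  simp only [pathNode] at hu
  rw [xorIndexLabel_other, xorIndexLabel_other] <;> omega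

lemma pathInput_left {n : ℕ} (h : 3 ≤ n) (x y y' : Fin n → Bool)
    (i j i' j' : Fin n) :
    pathInput n (xorIndexLabel x y i j) (pathNode n (n - 1) (by omega)) =
      pathInput n (xorIndexLabel x y' i' j') (pathNode n (n - 1) (by omega)) := by
  refine pathInput_congr ?_
  simp only [pathNode]
  rw [xorIndexLabel_left (by omega), xorIndexLabel_left (by omega)]

lemma pathInput_right {n : ℕ} (h : 3 ≤ n) (x x' y : Fin n → Bool)
    (i j i' j' : Fin n) :
    pathInput n (xorIndexLabel x y i j) (pathNode n (n + 1) (by omega)) =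
      pathInput n (xorIndexLabel x' y i' j') (pathNode n (n + 1) (by omega)) := by
  refine pathInput_congr ?_
  simp only [pathNode]
  rw [xorIndexLabel_right, xorIndexLabel_right]

lemma xorIndexLabel_congr_left {n : ℕ} (x x' y : Fin n → Bool) (i j : Fin n) {k : ℕ}
    (h : k ≠ n - 1) : xorIndexLabel x y i j k = xorIndexLabel x' y i j k := by
  unfold xorIndexLabel
  split_ifs <;> first | rfl | omega

lemma xorIndexLabel_congr_right {n : ℕ} (x y y' : Fin n → Bool) (i j : Fin n) {k : ℕ}
    (h : k ≠ n + 1) : xorIndexLabel x y i j k = xorIndexLabel x y' i j k := by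
  unfold xorIndexLabel
  split_ifs <;> rfl

/-- One conjunct is acceptance by all nodes except the holder of `y`, the other by all except the
holder of `x`; together they cover every node. -/
lemma splitsThrough_congest_bcc (A : Algorithm) {n : ℕ} (h : 3 ≤ n) :
    SplitsThrough (leftMessages A n h) (rightMessages A n h) (fun x y i j =>
      A.AllAccept scheduleCB (labeledPath n (xorIndexLabel x y i j)) (pathIdent n)) := by
  refine ⟨fun x y i j => ∀ v, v ≠ pathNode n (n + 1) (by omega) →
      AcceptsAt A n (xorIndexLabel x y i j) .congest .bcc v,
    fun x y i j => ∀ v, v ≠ pathNode n (n - 1) (by omega) →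
      AcceptsAt A n (xorIndexLabel x y i j) .congest .bcc v, ?_, ?_, ?_⟩
  · intro x y i j
    refine (allAccept_iff_acceptsAt A n _ .congest .bcc).trans ?_
    refine ⟨fun H => ⟨fun v _ => H v, fun v _ => H v⟩, fun ⟨H1, H2⟩ v => ?_⟩
    by_cases hv : v = pathNode n (n + 1) (by omega)
    · refine H2 v ?_
      rw [hv]
      simp only [pathNode, ne_eq, Fin.mk.injEq]
      omega
    · exact H1 v hv
  · intro x y y' i j hT
    refine forall₂_congr fun v hv => acceptsAt_congest_bcc_congr A
      (fun u hu => xorIndexLabel_congr_right _ _ _ _ _ fun e => hu (Fin.ext e)) ?_ ?_ hv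
    · intro u hu
      rw [pathGraph_adj] at hu
      rw [pathInput_right h x (fun _ => false) y i j ⟨0, by omega⟩ ⟨0, by omega⟩,
        pathInput_right h x (fun _ => false) y' i j ⟨0, by omega⟩ ⟨0, by omega⟩]
      simp only [pathNode] at hu
      rcases hu with hu | hu
      · have e : pathIdent n u = n + 1 := by simpa [pathIdent] using hu
        rw [e]
        exact congrFun hT 0
      · have e : pathIdent n u = n + 3 := by simp [pathIdent]; omega
        rw [e]
        exact congrFun hT 1
    · rw [pathInput_right h x (fun _ => false) y i j ⟨0, by omega⟩ ⟨0, by omega⟩,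
        pathInput_right h x (fun _ => false) y' i j ⟨0, by omega⟩ ⟨0, by omega⟩,
        firstInbox_right A h x y (fun _ => false) y i j ⟨0, by omega⟩ ⟨0, by omega⟩,
        firstInbox_right A h x y' (fun _ => false) y' i j ⟨0, by omega⟩ ⟨0, by omega⟩]
      exact congrFun hT 2
  · intro x x' y i j hS
    refine forall₂_congr fun v hv => acceptsAt_congest_bcc_congr A
      (fun u hu => xorIndexLabel_congr_left _ _ _ _ _ fun e => hu (Fin.ext e)) ?_ ?_ hv
    · intro u hu
      rw [pathGraph_adj] at hu
      rw [pathInput_left h x y (fun _ => false) i j ⟨0, by omega⟩ ⟨0, by omega⟩,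
        pathInput_left h x' y (fun _ => false) i j ⟨0, by omega⟩ ⟨0, by omega⟩]
      simp only [pathNode] at hu
      rcases hu with hu | hu
      · have e : pathIdent n u = n - 1 := by simpa [pathIdent] using hu
        rw [e]
        exact congrFun hS 0
      · have e : pathIdent n u = n + 1 := by simp [pathIdent]; omega
        rw [e]
        exact congrFun hS 1
    · rw [pathInput_left h x y (fun _ => false) i j ⟨0, by omega⟩ ⟨0, by omega⟩,
        pathInput_left h x' y (fun _ => false) i j ⟨0, by omega⟩ ⟨0, by omega⟩,
        firstInbox_left A h x y x (fun _ => false) i j ⟨0, by omega⟩ ⟨0, by omega⟩,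
        firstInbox_left A h x' y x' (fun _ => false) i j ⟨0, by omega⟩ ⟨0, by omega⟩]
      exact congrFun hS 2

lemma Algorithm.HasBandwidth.send_path {A : Algorithm} {C : ℕ} (hA : A.HasBandwidth C) {n : ℕ}
    (ℓ : ℕ → BitString) (v : Fin (2 * n + 1)) (h : List Inbox) (k : ℕ) :
    (A.send (pathInput n ℓ v) h k).length ≤ C * (Nat.log 2 (2 * n + 1) + 1) := by
  have := (hA (pathInput n ℓ v) h).2 k
  rwa [pathInput_order] at this

lemma Algorithm.HasBandwidth.broadcast_path {A : Algorithm} {C : ℕ} (hA : A.HasBandwidth C)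
    {n : ℕ} (ℓ : ℕ → BitString) (v : Fin (2 * n + 1)) (h : List Inbox) :
    (A.broadcast (pathInput n ℓ v) h).length ≤ C * (Nat.log 2 (2 * n + 1) + 1) := by
  have := (hA (pathInput n ℓ v) h).1
  rwa [pathInput_order] at this

theorem xorIndexPath_not_mem_randomizedDecisionClass_congest_bcc {N : ℕ → ℕ}
    (hN : ∀ n, n ≤ N n) {ε : ℝ} (hε : ε < 1 / 5) :
    xorIndexPath ∉ RandomizedDecisionClass N scheduleCB ε := by
  refine not_mem_randomizedDecisionClass hN hε fun C => ?_
  obtain ⟨n, hn, H⟩ := exists_xorError_sum_ge C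
  refine ⟨n, hn, fun x y i j => xorIndexLabel x y i j,
    fun x y i j => labeledPath_mem_xorIndexPath (by omega) x y i j, fun A hA => ?_⟩
  refine H _ _ _ ?_ ?_ (splitsThrough_congest_bcc A hn)
  · intro x k
    simp only [leftMessages]
    split_ifs
    exacts [hA.send_path _ _ _ _, hA.send_path _ _ _ _, hA.broadcast_path _ _ _]
  · intro x k
    simp only [rightMessages]
    split_ifs
    exacts [hA.send_path _ _ _ _, hA.send_path _ _ _ _, hA.broadcast_path _ _ _]

end HybridModels

/-! ### A language for CONGEST followed by BCC that the reverse order cannot decide -/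

namespace HybridModels

open Finset SimpleGraph

/-- `l` is a tagged string of data, `m` is a tagged index, and the bit of `l` at this index is set. -/
def ReadsTrue (l m : BitString) : Prop :=
  ∃ (l' : BitString) (k : ℕ), l = true :: l' ∧ m = false :: Nat.bits k ∧ l'[k]? = some true

/-- The prefix of `l` that is sent in `n`-node networks. -/
def shortPrefix (n : ℕ) (l : BitString) : BitString := l.take (2 * (Nat.log 2 n + 1))

/-- Some neighbor of `v` holds the index of a bit of the label of `v` that is set. -/
def LabeledGraph.ReadByNeighbor (X : LabeledGraph) (v : X.V) : Prop :=
  ∃ u, X.graph.Adj v u ∧ ReadsTrue (X.label v) (shortPrefix X.order (X.label u))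

open Classical in
/-- The labeled graphs with an odd number of nodes that have a set bit indexed by a neighbor. -/
def neighborIndexParity : Set LabeledGraph :=
  {X | Odd (univ.filter fun v => X.ReadByNeighbor v).card}

open Classical in
/-- The nodes send their labels to their neighbors and broadcast the bit that they find. -/
noncomputable def neighborIndexAlgorithm : Algorithm where
  broadcast I h := [decide (∃ p ∈ h.headD ∅, ReadsTrue I.label p.2)]
  send I _ _ := shortPrefix I.order I.label
  accept _ h := decide (Odd ((h.getLastD ∅).filter fun p => p.2 = [true]).card)

lemma neighborIndexParity_mem_decisionClass (N : ℕ → ℕ) :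
    neighborIndexParity ∈ DecisionClass N scheduleCB := by
  classical
  refine ⟨neighborIndexAlgorithm, 2, fun I h => ⟨?_, fun k => ?_⟩, fun X ident hX => ?_⟩
  · simp only [neighborIndexAlgorithm, List.length_singleton]; omega
  · simp [neighborIndexAlgorithm, shortPrefix]
  · have hread : ∀ u, (∃ p ∈ neighborIndexAlgorithm.inbox X ident (fun _ => []) u .congest,
        ReadsTrue (X.label u) p.2) ↔ X.ReadByNeighbor u := by
      intro u
      simp only [Algorithm.inbox, mem_image, mem_filter, mem_univ, true_and]
      constructor
      · rintro ⟨_, ⟨w, hw, rfl⟩, h⟩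
        exact ⟨w, hw, h⟩
      · rintro ⟨w, hw, h⟩
        exact ⟨_, ⟨w, hw, rfl⟩, h⟩
    have hacc : ∀ v, neighborIndexAlgorithm.accept (X.localInput ident v)
        (neighborIndexAlgorithm.run X ident scheduleCB (fun _ => []) v) = true ↔
        X ∈ neighborIndexParity := by
      intro v
      have h1 : neighborIndexAlgorithm.run X ident scheduleCB (fun _ => []) v =
          [neighborIndexAlgorithm.inbox X ident (fun _ => []) v .congest,
            univ.image fun u => (ident u, [decide (X.ReadByNeighbor u)])] := by
        simp only [Algorithm.run, List.nil_append, List.cons_append, List.cons.injEq, true_and,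
          and_true]
        simp only [Algorithm.inbox]
        refine Finset.image_congr fun u _ => ?_
        rw [Prod.mk.injEq]
        refine ⟨rfl, ?_⟩
        have := hread u
        simp only [Algorithm.inbox] at this
        simp only [← this]
        rfl
      rw [h1]
      simp only [neighborIndexAlgorithm, decide_eq_true_eq, neighborIndexParity, Set.mem_ofPred_eq]
      have h2 : ∀ B : Inbox, ([neighborIndexAlgorithm.inbox X ident (fun _ => []) v .congest,
        B] : List Inbox).getLastD ∅ = B := fun _ => rfl
      simp only [neighborIndexAlgorithm] at h2
      -- Messages carry distinct identifiers, so equal bits from different nodes are counted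
      -- separately.
      rw [h2, Finset.filter_image, Finset.card_image_of_injective]
      · simp
      · intro a b hab
        exact hX.1 (congrArg Prod.fst hab)
    obtain ⟨v0⟩ := X.nonemptyV
    exact ⟨fun h v => (hacc v).mpr h, fun h => (hacc v0).mp (h v0)⟩

/-- The labels `x, j, i, y` at the nodes `0, 1, 2n - 1, 2n`. -/
def endIndexLabel {n : ℕ} (x y : Fin n → Bool) (i j : Fin n) (k : ℕ) : BitString :=
  if k = 0 then true :: List.ofFn x
  else if k = 1 then false :: Nat.bits j
  else if k + 1 = 2 * n then false :: Nat.bits i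
  else if k = 2 * n then true :: List.ofFn y
  else []

lemma shortPrefix_index {n : ℕ} (k : Fin n) :
    shortPrefix (2 * n + 1) (false :: Nat.bits k) = false :: Nat.bits k := by
  unfold shortPrefix
  apply List.take_of_length_le
  have h1 : Nat.size k ≤ Nat.log 2 (2 * n + 1) + 1 := by
    rw [Nat.size_le]
    have h2 : 2 * n + 1 < 2 ^ (Nat.log 2 (2 * n + 1) + 1) := Nat.lt_pow_succ_log_self (by omega) _
    have := k.isLt
    omega
  rw [List.length_cons, Nat.size_eq_bits_len]
  omega

lemma readsTrue_ofFn {n : ℕ} (x : Fin n → Bool) (k : Fin n) :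
    ReadsTrue (true :: List.ofFn x) (false :: Nat.bits k) ↔ x k = true := by
  constructor
  · rintro ⟨l, k', h1, h2, h3⟩
    have hk := natBits_injective (List.cons.inj h2).2
    rw [← (List.cons.inj h1).2, ← hk] at h3
    simpa using h3
  · intro h
    exact ⟨_, k, rfl, rfl, by simp [h]⟩

lemma not_readsTrue_of_head {l m : BitString} (h : l.head? ≠ some true) : ¬ ReadsTrue l m := by
  rintro ⟨l', k, rfl, -⟩
  simp at h

lemma readByNeighbor_labeledPath {n : ℕ} (ℓ : ℕ → BitString) (v : Fin (2 * n + 1)) :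
    (labeledPath n ℓ).ReadByNeighbor v ↔ ∃ u : Fin (2 * n + 1), (pathGraph (2 * n + 1)).Adj v u ∧
      ReadsTrue (ℓ v) (shortPrefix (2 * n + 1) (ℓ u)) := by
  unfold LabeledGraph.ReadByNeighbor
  rw [labeledPath_order]
  rfl

/-- Only the two ends carry data tags, and the single neighbor of each end holds its index. -/
lemma readByNeighbor_endIndexLabel {n : ℕ} (hn : 2 ≤ n) (x y : Fin n → Bool) (i j : Fin n)
    (v : Fin (2 * n + 1)) :
    (labeledPath n (endIndexLabel x y i j)).ReadByNeighbor v ↔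
      ((v : ℕ) = 0 ∧ x j = true) ∨ ((v : ℕ) = 2 * n ∧ y i = true) := by
  have e0 : endIndexLabel x y i j 0 = true :: List.ofFn x := by simp [endIndexLabel]
  have e1 : endIndexLabel x y i j 1 = false :: Nat.bits j := by simp [endIndexLabel]
  have e2 : endIndexLabel x y i j (2 * n - 1) = false :: Nat.bits i := by
    unfold endIndexLabel
    rw [if_neg (by omega), if_neg (by omega), if_pos (by omega)]
  have e3 : endIndexLabel x y i j (2 * n) = true :: List.ofFn y := by
    unfold endIndexLabel
    rw [if_neg (by omega), if_neg (by omega), if_neg (by omega), if_pos rfl]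
  rw [readByNeighbor_labeledPath]
  constructor
  · rintro ⟨u, hu, h⟩
    rw [pathGraph_adj] at hu
    by_cases h0 : (v : ℕ) = 0
    · have : (u : ℕ) = 1 := by omega
      rw [h0, this, e0, e1, shortPrefix_index, readsTrue_ofFn] at h
      exact Or.inl ⟨h0, h⟩
    by_cases h3 : (v : ℕ) = 2 * n
    · have : (u : ℕ) = 2 * n - 1 := by omega
      rw [h3, this, e3, e2, shortPrefix_index, readsTrue_ofFn] at h
      exact Or.inr ⟨h3, h⟩
    exfalso
    refine not_readsTrue_of_head ?_ h
    unfold endIndexLabel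
    rw [if_neg h0]
    split_ifs <;> simp
  · rintro (⟨h0, h⟩ | ⟨h3, h⟩)
    · refine ⟨pathNode n 1 (by omega), ?_, ?_⟩
      · rw [pathGraph_adj]; simp [pathNode, h0]
      · have : ((pathNode n 1 (by omega) : Fin (2 * n + 1)) : ℕ) = 1 := rfl
        rw [h0, this, e0, e1, shortPrefix_index, readsTrue_ofFn]
        exact h
    · refine ⟨pathNode n (2 * n - 1) (by omega), ?_, ?_⟩
      · rw [pathGraph_adj]; simp [pathNode, h3]; omega
      · have : ((pathNode n (2 * n - 1) (by omega) : Fin (2 * n + 1)) : ℕ) = 2 * n - 1 := rfl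
        rw [h3, this, e3, e2, shortPrefix_index, readsTrue_ofFn]
        exact h

lemma mem_neighborIndexParity_iff (X : LabeledGraph) :
    X ∈ neighborIndexParity ↔ Odd (Nat.card {v // X.ReadByNeighbor v}) := by
  classical
  rw [Nat.card_eq_fintype_card, Fintype.card_subtype]
  unfold neighborIndexParity
  rw [Set.mem_ofPred_eq]

lemma labeledPath_mem_neighborIndexParity {n : ℕ} (hn : 2 ≤ n) (x y : Fin n → Bool)
    (i j : Fin n) :
    labeledPath n (endIndexLabel x y i j) ∈ neighborIndexParity ↔ x j ≠ y i := by
  classical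
  have h : labeledPath n (endIndexLabel x y i j) ∈ neighborIndexParity ↔ Odd (univ.filter
      fun v : Fin (2 * n + 1) =>
        ((v : ℕ) = 0 ∧ x j = true) ∨ ((v : ℕ) = 2 * n ∧ y i = true)).card := by
    rw [mem_neighborIndexParity_iff, ← Fintype.card_subtype, ← Nat.card_eq_fintype_card,
      ← Nat.card_congr (Equiv.subtypeEquivRight (readByNeighbor_endIndexLabel hn x y i j))]
    rfl
  have h' : (univ.filter fun v : Fin (2 * n + 1) =>
        ((v : ℕ) = 0 ∧ x j = true) ∨ ((v : ℕ) = 2 * n ∧ y i = true)) =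
      (if x j = true then {pathNode n 0 (by omega)} else ∅) ∪
        (if y i = true then {pathNode n (2 * n) (by omega)} else ∅) := by
    ext v
    have k1 : v = pathNode n 0 (by omega) ↔ (v : ℕ) = 0 := Fin.ext_iff
    have k2 : v = pathNode n (2 * n) (by omega) ↔ (v : ℕ) = 2 * n := Fin.ext_iff
    cases x j <;> cases y i <;> simp [k1, k2]
  rw [h, h']
  have hne : pathNode n 0 (by omega) ≠ pathNode n (2 * n) (by omega) := by
    simp only [pathNode, ne_eq, Fin.mk.injEq]; omega
  have hp := Finset.card_pair hne
  cases x j <;> cases y i <;> simp [hp]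

lemma endIndexLabel_congr_left {n : ℕ} (x x' y : Fin n → Bool) (i j : Fin n) {k : ℕ}
    (h : k ≠ 0) : endIndexLabel x y i j k = endIndexLabel x' y i j k := by
  unfold endIndexLabel
  rw [if_neg h, if_neg h]

lemma endIndexLabel_congr_right {n : ℕ} (x y y' : Fin n → Bool) (i j : Fin n) {k : ℕ}
    (h : k ≠ 2 * n) : endIndexLabel x y i j k = endIndexLabel x y' i j k := by
  unfold endIndexLabel
  rw [if_neg h, if_neg h]

lemma pathInput_first {n : ℕ} (x y y' : Fin n → Bool) (i j i' j' : Fin n) :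
    pathInput n (endIndexLabel x y i j) (pathNode n 0 (by omega)) =
      pathInput n (endIndexLabel x y' i' j') (pathNode n 0 (by omega)) :=
  pathInput_congr (by simp [endIndexLabel, pathNode])

lemma pathInput_last {n : ℕ} (hn : 2 ≤ n) (x x' y : Fin n → Bool) (i j i' j' : Fin n) :
    pathInput n (endIndexLabel x y i j) (pathNode n (2 * n) (by omega)) =
      pathInput n (endIndexLabel x' y i' j') (pathNode n (2 * n) (by omega)) := by
  refine pathInput_congr ?_
  have h0 : n ≠ 0 := by omega
  have h1 : 2 * n ≠ 1 := by omega
  simp [endIndexLabel, pathNode, h0, h1]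

/-- Beyond its broadcast, the label of an end affects only that end and its neighbor in the CONGEST
round. The exceptional pairs at the two ends are disjoint. Each broadcast is repeated three times to
fit the common counting bound. -/
lemma splitsThrough_bcc_congest (A : Algorithm) {n : ℕ} (h : 3 ≤ n) :
    SplitsThrough
      (fun (x : Fin n → Bool) (_ : Fin 3) => A.broadcast (pathInput n (endIndexLabel x (fun _ => false)
        ⟨0, by omega⟩ ⟨0, by omega⟩) (pathNode n 0 (by omega))) [])
      (fun (y : Fin n → Bool) (_ : Fin 3) => A.broadcast (pathInput n (endIndexLabel (fun _ => false) y
        ⟨0, by omega⟩ ⟨0, by omega⟩) (pathNode n (2 * n) (by omega))) [])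
      (fun x y i j =>
        A.AllAccept scheduleBC (labeledPath n (endIndexLabel x y i j)) (pathIdent n)) := by
  refine ⟨fun x y i j => ∀ v, v ≠ pathNode n (2 * n) (by omega) ∧
        ¬ (pathGraph (2 * n + 1)).Adj v (pathNode n (2 * n) (by omega)) →
      AcceptsAt A n (endIndexLabel x y i j) .bcc .congest v,
    fun x y i j => ∀ v, v ≠ pathNode n 0 (by omega) ∧
        ¬ (pathGraph (2 * n + 1)).Adj v (pathNode n 0 (by omega)) →
      AcceptsAt A n (endIndexLabel x y i j) .bcc .congest v, ?_, ?_, ?_⟩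
  · intro x y i j
    refine (allAccept_iff_acceptsAt A n _ .bcc .congest).trans ?_
    refine ⟨fun H => ⟨fun v _ => H v, fun v _ => H v⟩, fun ⟨H1, H2⟩ v => ?_⟩
    by_cases hv : (v : ℕ) < 2 * n - 1
    · refine H1 v ⟨fun e => ?_, ?_⟩
      · have : (v : ℕ) = 2 * n := congrArg Fin.val e
        omega
      · rw [pathGraph_adj]
        simp only [pathNode]
        omega
    · refine H2 v ⟨fun e => ?_, ?_⟩
      · have : (v : ℕ) = 0 := congrArg Fin.val e
        omega
      · rw [pathGraph_adj]
        simp only [pathNode]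
        omega
  · intro x y y' i j hT
    refine forall₂_congr fun v hv => acceptsAt_bcc_congest_congr A
      (fun u hu => endIndexLabel_congr_right _ _ _ _ _ fun e => hu (Fin.ext e)) ?_ hv.1 hv.2
    rw [pathInput_last (by omega) x (fun _ => false) y i j ⟨0, by omega⟩ ⟨0, by omega⟩,
      pathInput_last (by omega) x (fun _ => false) y' i j ⟨0, by omega⟩ ⟨0, by omega⟩]
    exact congrFun hT 0
  · intro x x' y i j hS
    refine forall₂_congr fun v hv => acceptsAt_bcc_congest_congr A
      (fun u hu => endIndexLabel_congr_left _ _ _ _ _ fun e => hu (Fin.ext e)) ?_ hv.1 hv.2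
    rw [pathInput_first x y (fun _ => false) i j ⟨0, by omega⟩ ⟨0, by omega⟩,
      pathInput_first x' y (fun _ => false) i j ⟨0, by omega⟩ ⟨0, by omega⟩]
    exact congrFun hS 0

theorem neighborIndexParity_not_mem_randomizedDecisionClass_bcc_congest {N : ℕ → ℕ}
    (hN : ∀ n, n ≤ N n) {ε : ℝ} (hε : ε < 1 / 5) :
    neighborIndexParity ∉ RandomizedDecisionClass N scheduleBC ε := by
  refine not_mem_randomizedDecisionClass hN hε fun C => ?_
  obtain ⟨n, hn, H⟩ := exists_xorError_sum_ge C
  refine ⟨n, hn, fun x y i j => endIndexLabel x y i j,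
    fun x y i j => labeledPath_mem_neighborIndexParity (by omega) x y i j, fun A hA => ?_⟩
  refine H _ _ _ ?_ ?_ (splitsThrough_bcc_congest A hn)
  · exact fun _ _ => hA.broadcast_path _ _ _
  · exact fun _ _ => hA.broadcast_path _ _ _

end HybridModels

/-! ### The algorithm with BCC followed by CONGEST for XOR-index-path -/

namespace HybridModels

open Finset SimpleGraph

/-- A self-delimiting encoding of lists of bit strings. -/
def encodeList : List BitString → BitString
  | [] => []
  | l :: t => l.flatMap (fun b => [true, b]) ++ false :: encodeList t

/-- Every data bit is preceded by `true`, so the first `false` in a marker position ends the string.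
-/
lemma flatMap_append_inj : ∀ {l l' r r' : BitString},
    l.flatMap (fun b => [true, b]) ++ false :: r = l'.flatMap (fun b => [true, b]) ++ false :: r' →
    l = l' ∧ r = r'
  | [], [], _, _, h => by simpa using h
  | [], _ :: _, _, _, h => by simp at h
  | _ :: _, [], _, _, h => by simp at h
  | a :: l, b :: l', r, r', h => by
    simp only [List.flatMap_cons, List.cons_append, List.nil_append, List.cons.injEq,
      true_and] at h
    obtain ⟨h1, h2⟩ := flatMap_append_inj h.2
    exact ⟨by rw [h.1, h1], h2⟩

lemma encodeList_injective : Function.Injective encodeList := by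
  intro L
  induction L with
  | nil =>
    intro L' h
    cases L' with
    | nil => rfl
    | cons l t => simp [encodeList] at h
  | cons l t ih =>
    intro L' h
    cases L' with
    | nil => simp [encodeList] at h
    | cons l' t' =>
      obtain ⟨h1, h2⟩ := flatMap_append_inj h
      rw [h1, ih h2]

lemma length_encodeList_le {b : ℕ} : ∀ {L : List BitString}, (∀ l ∈ L, l.length ≤ b) →
    (encodeList L).length ≤ L.length * (2 * b + 1)
  | [], _ => by simp [encodeList]
  | l :: t, h => by
    have h1 := length_encodeList_le (L := t) fun l hl => h l (List.mem_cons_of_mem _ hl)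
    have h2 := h l List.mem_cons_self
    have h3 : (l.flatMap fun b => [true, b]).length = 2 * l.length := by
      simp [List.length_flatMap, mul_comm]
    simp only [encodeList, List.length_append, List.length_cons, h3, add_mul, one_mul]
    omega

/-- The label, tagged, if it has at most `⌊log₂ n⌋ + 1` bits. -/
def shortLabel (n : ℕ) (l : BitString) : BitString :=
  -- The tag distinguishes the empty label from a label that is too long.
  if l.length ≤ Nat.log 2 n + 1 then true :: l else []

lemma eq_of_shortLabel_eq {n : ℕ} {l l' : BitString} (hl : l'.length ≤ Nat.log 2 n + 1)
    (h : shortLabel n l = shortLabel n l') : l = l' := by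
  unfold shortLabel at h
  rw [if_pos hl] at h
  split_ifs at h
  simpa using h

/-- The neighbors of a node, and its label if it is short. -/
def nodeSummary (I : LocalInput) : BitString :=
  encodeList (shortLabel I.order I.label :: I.nbrs.sort.map Nat.bits)

lemma nodeSummary_eq {I I' : LocalInput} (h : nodeSummary I = nodeSummary I') :
    shortLabel I.order I.label = shortLabel I'.order I'.label ∧ I.nbrs = I'.nbrs := by
  have h1 := encodeList_injective h
  rw [List.cons.injEq] at h1
  refine ⟨h1.1, ?_⟩
  have h2 := List.map_injective_iff.mpr natBits_injective h1.2
  rw [← Finset.sort_toFinset I.nbrs (· ≤ ·), h2, Finset.sort_toFinset]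

/-- The constant in the size of the summaries, if identifiers are at most `n ^ d + d`. -/
def summaryConst (d : ℕ) : ℕ := 12 * d + 18

lemma length_nodeSummary_le {d : ℕ} {I : LocalInput} (h2 : I.nbrs.card ≤ 2)
    (hN : ∀ a ∈ I.nbrs, a ≤ I.order ^ d + d) :
    (nodeSummary I).length ≤ summaryConst d * (Nat.log 2 I.order + 1) := by
  set m := Nat.log 2 I.order + 1 with hm
  have hm1 : 1 ≤ m := by omega
  have hlen : ∀ l ∈ shortLabel I.order I.label :: I.nbrs.sort.map Nat.bits,
      l.length ≤ (2 * d + 2) * m := by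
    intro l hl
    rcases List.mem_cons.mp hl with rfl | hl
    · unfold shortLabel
      split_ifs with h
      · rw [List.length_cons]
        nlinarith
      · simp
    · obtain ⟨a, ha, rfl⟩ := List.mem_map.mp hl
      have ha' := hN a ((Finset.mem_sort _).mp ha)
      rw [Nat.size_eq_bits_len, Nat.size_le]
      have h3 : I.order < 2 ^ m := Nat.lt_pow_succ_log_self (by omega) _
      have h4 : I.order ^ d ≤ 2 ^ (m * d) := by
        rw [pow_mul]; exact Nat.pow_le_pow_left h3.le d
      have h5 : d < 2 ^ d := Nat.lt_two_pow_self
      have h6 : 2 ^ (m * d) ≤ 2 ^ (2 * d * m + m) := Nat.pow_le_pow_right (by omega) (by nlinarith)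
      have h7 : 2 ^ d ≤ 2 ^ (2 * d * m + m) := Nat.pow_le_pow_right (by omega) (by nlinarith)
      have h8 : 2 ^ (2 * d * m + m + 1) ≤ 2 ^ ((2 * d + 2) * m) :=
        Nat.pow_le_pow_right (by omega) (by nlinarith)
      rw [pow_succ] at h8
      omega
  have h3 := length_encodeList_le hlen
  have h4 : (shortLabel I.order I.label :: I.nbrs.sort.map Nat.bits).length ≤ 3 := by
    simp only [List.length_cons, List.length_map, Finset.length_sort]
    omega
  calc (nodeSummary I).length ≤ _ := h3
    _ ≤ 3 * (2 * ((2 * d + 2) * m) + 1) := Nat.mul_le_mul_right _ h4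
    _ ≤ summaryConst d * m := by unfold summaryConst; nlinarith

/-- The message that a node broadcasts to let all nodes know the path and the indices. -/
def pathBroadcast (d : ℕ) (I : LocalInput) : BitString :=
  (nodeSummary I).take (summaryConst d * (Nat.log 2 I.order + 1))

open Classical in
/-- The common inbox of all nodes after they broadcast their summaries. -/
noncomputable def broadcastInbox (d : ℕ) (X : LabeledGraph) (ident : X.V → ℕ) : Inbox :=
  univ.image fun u => (ident u, pathBroadcast d (X.localInput ident u))

lemma card_broadcastInbox (d : ℕ) {N : ℕ → ℕ} {X : LabeledGraph} {ident : X.V → ℕ}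
    (hX : ValidIds N X ident) : (broadcastInbox d X ident).card = X.order := by
  classical
  unfold broadcastInbox
  rw [Finset.card_image_of_injective _ fun a b h => hX.1 (congrArg Prod.fst h)]
  rfl

lemma mem_nbrs_localInput {N : ℕ → ℕ} {X : LabeledGraph} {ident : X.V → ℕ}
    (hX : ValidIds N X ident) (u w : X.V) :
    ident w ∈ (X.localInput ident u).nbrs ↔ X.graph.Adj u w := by
  classical
  simp only [LabeledGraph.localInput, mem_image, mem_filter, mem_univ, true_and]
  exact ⟨fun ⟨a, ha, e⟩ => hX.1 e ▸ ha, fun h => ⟨w, h, rfl⟩⟩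

lemma pathBroadcast_eq {N : ℕ → ℕ} {d : ℕ} (hN : ∀ n, N n ≤ n ^ d + d) {X : LabeledGraph}
    {ident : X.V → ℕ} (hX : ValidIds N X ident) {u : X.V}
    (hu : (X.localInput ident u).nbrs.card ≤ 2) :
    pathBroadcast d (X.localInput ident u) = nodeSummary (X.localInput ident u) := by
  classical
  refine List.take_of_length_le (length_nodeSummary_le hu fun a ha => ?_)
  simp only [LabeledGraph.localInput, mem_image] at ha
  obtain ⟨w, -, rfl⟩ := ha
  exact (hX.2 w).2.trans (hN _)

lemma card_nbrs_le_two {X : LabeledGraph} (ident : X.V → ℕ) {m : ℕ} (φ : pathGraph m ≃g X.graph)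
    (u : X.V) : (X.localInput ident u).nbrs.card ≤ 2 := by
  classical
  simp only [LabeledGraph.localInput]
  refine Finset.card_image_le.trans ?_
  refine (Finset.card_le_card_of_injOn (fun w => (φ.symm w : ℕ))
    (t := {(φ.symm u : ℕ) - 1, (φ.symm u : ℕ) + 1}) ?_ ?_).trans Finset.card_le_two
  · intro w hw
    have hw' : X.graph.Adj u w := by simpa using hw
    rw [← φ.symm.map_adj_iff, pathGraph_adj] at hw'
    simp only [coe_insert, coe_singleton, Set.mem_insert_iff, Set.mem_singleton_iff]
    omega
  · intro a _ b _ h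
    exact φ.symm.injective (Fin.ext h)

/-- Two networks of maximum degree `2` with the same broadcast messages are isomorphic. -/
lemma exists_iso_of_broadcastInbox_eq {N : ℕ → ℕ} {d : ℕ} (hN : ∀ n, N n ≤ n ^ d + d)
    {X X' : LabeledGraph} {ident : X.V → ℕ} {ident' : X'.V → ℕ} (hX : ValidIds N X ident)
    (hX' : ValidIds N X' ident') (hdeg : ∀ u, (X.localInput ident u).nbrs.card ≤ 2)
    (hdeg' : ∀ u, (X'.localInput ident' u).nbrs.card ≤ 2)
    (h : broadcastInbox d X ident = broadcastInbox d X' ident') :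
    ∃ e : X.graph ≃g X'.graph, (∀ u, ident' (e u) = ident u) ∧
      ∀ u, shortLabel X.order (X.label u) = shortLabel X.order (X'.label (e u)) := by
  classical
  have horder : X.order = X'.order := by
    rw [← card_broadcastInbox d hX, h, card_broadcastInbox d hX']
  have hex : ∀ u, ∃ u', ident' u' = ident u ∧
      nodeSummary (X'.localInput ident' u') = nodeSummary (X.localInput ident u) := by
    intro u
    have hu : (ident u, pathBroadcast d (X.localInput ident u)) ∈ broadcastInbox d X ident :=
      Finset.mem_image_of_mem _ (mem_univ u)
    rw [h] at hu
    obtain ⟨u', -, hu'⟩ := Finset.mem_image.mp hu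
    rw [Prod.mk.injEq, pathBroadcast_eq hN hX (hdeg u), pathBroadcast_eq hN hX' (hdeg' u')] at hu'
    exact ⟨u', hu'⟩
  choose f hf using hex
  have hinj : Function.Injective f := fun a b hab => by
    apply hX.1
    rw [← (hf a).1, hab, (hf b).1]
  have hbij : Function.Bijective f :=
    (Fintype.bijective_iff_injective_and_card f).mpr ⟨hinj, horder⟩
  -- Adjacency is read off the broadcast neighbor lists, since `f` preserves identifiers.
  refine ⟨⟨Equiv.ofBijective f hbij, ?_⟩, fun u => (hf u).1, fun u => ?_⟩
  · intro u w
    rw [Equiv.ofBijective_apply, Equiv.ofBijective_apply, ← mem_nbrs_localInput hX',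
      ← mem_nbrs_localInput hX, (nodeSummary_eq (hf u).2).2, (hf w).1]
  · have h1 := (nodeSummary_eq (hf u).2).1
    simp only [LabeledGraph.localInput] at h1
    rw [← horder] at h1
    exact h1.symm

lemma length_bits_succ_le {n : ℕ} (i : Fin n) :
    (Nat.bits (i + 1)).length ≤ Nat.log 2 (2 * n + 1) + 1 := by
  rw [Nat.size_eq_bits_len, Nat.size_le]
  have h2 : 2 * n + 1 < 2 ^ (Nat.log 2 (2 * n + 1) + 1) := Nat.lt_pow_succ_log_self (by omega) _
  have := i.isLt
  omega

lemma order_of_path_iso {X : LabeledGraph} {m : ℕ} (φ : pathGraph m ≃g X.graph) : X.order = m := by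
  have := Fintype.card_congr φ.toEquiv
  rw [Fintype.card_fin] at this
  exact this.symm

/-- A labeled path in the language with the same broadcast messages as `X` agrees with `X`
on the identifiers and on the indices. -/
lemma exists_params_of_broadcastInbox_eq {N : ℕ → ℕ} {d : ℕ} (hN : ∀ n, N n ≤ n ^ d + d)
    {X X' : LabeledGraph} {ident : X.V → ℕ} {ident' : X'.V → ℕ} (hX : ValidIds N X ident)
    (hX' : ValidIds N X' ident') (hL : X' ∈ xorIndexPath) {n : ℕ}
    (φ : pathGraph (2 * n + 1) ≃g X.graph)
    (h : broadcastInbox d X ident = broadcastInbox d X' ident') :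
    2 ≤ n ∧ ∃ e : X.graph ≃g X'.graph, (∀ u, ident' (e u) = ident u) ∧
      ∃ (x y : Fin n → Bool) (i j : Fin n), x j ≠ y i ∧
        IsXorIndexPath X' x y i j (φ.trans e) ∧
        X.label (φ (pathNode n 0 (by omega))) = Nat.bits (i + 1) ∧
        X.label (φ (pathNode n (2 * n) (by omega))) = Nat.bits (j + 1) := by
  have hdeg' : ∀ u, (X'.localInput ident' u).nbrs.card ≤ 2 := by
    obtain ⟨m, x, y, i, j, hm, hxy, ψ, hψ⟩ := hL
    exact card_nbrs_le_two ident' ψ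
  obtain ⟨e, he, hs⟩ :=
    exists_iso_of_broadcastInbox_eq hN hX hX' (card_nbrs_le_two ident φ) hdeg' h
  obtain ⟨hn, x, y, i, j, hxy, hl⟩ := exists_isXorIndexPath hL (φ.trans e)
  rw [order_of_path_iso φ] at hs
  refine ⟨hn, e, he, x, y, i, j, hxy, hl, ?_, ?_⟩
  · refine eq_of_shortLabel_eq (length_bits_succ_le i) ((hs _).trans ?_)
    rw [← xorIndexLabel_zero x y i j]
    exact congrArg _ (hl (pathNode n 0 (by omega)))
  · refine eq_of_shortLabel_eq (length_bits_succ_le j) ((hs _).trans ?_)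
    rw [← xorIndexLabel_last hn x y i j]
    exact congrArg _ (hl (pathNode n (2 * n) (by omega)))

lemma IsXorIndexPath.index_eq {X : LabeledGraph} {n m : ℕ} (hn : 2 ≤ n) {x y : Fin n → Bool}
    {i j : Fin n} {φ : pathGraph (2 * n + 1) ≃g X.graph} {x' y' : Fin m → Bool}
    {i' j' : Fin m} {ψ : pathGraph (2 * m + 1) ≃g X.graph} (h : IsXorIndexPath X x y i j φ)
    (h' : IsXorIndexPath X x' y' i' j' ψ) :
    ((i' : ℕ) = i ∧ (j' : ℕ) = j) ∨ ((i' : ℕ) = j ∧ (j' : ℕ) = i) := by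
  have hmn : m = n := by
    have h1 := order_of_path_iso φ
    have h2 := order_of_path_iso ψ
    omega
  subst hmn
  have hend : ∀ {x y : Fin m → Bool} {i j : Fin m} {φ : pathGraph (2 * m + 1) ≃g X.graph},
      IsXorIndexPath X x y i j φ →
      (∀ k, φ k = ψ k) → i' = i ∧ j' = j := by
    intro x y i j φ h hk
    have h0 := (h' (pathNode m 0 (by omega))).symm.trans ((congrArg _ (hk _).symm).trans (h _))
    have h1 := (h' (pathNode m (2 * m) (by omega))).symm.trans
      ((congrArg _ (hk _).symm).trans (h _))
    simp only [pathNode] at h0 h1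
    rw [xorIndexLabel_zero, xorIndexLabel_zero] at h0
    rw [xorIndexLabel_last hn, xorIndexLabel_last hn] at h1
    exact ⟨natBits_succ_inj h0, natBits_succ_inj h1⟩
  rcases pathGraph_iso_eq (φ.trans ψ.symm) with hk | hk
  · obtain ⟨e1, e2⟩ := hend h fun k => by
      have := congrArg ψ (hk k)
      rwa [RelIso.trans_apply, RelIso.apply_symm_apply] at this
    exact Or.inl ⟨congrArg _ e1, congrArg _ e2⟩
  · obtain ⟨e1, e2⟩ := hend (h.rev hn) fun k => by
      have := congrArg ψ (hk k)
      rwa [RelIso.trans_apply, RelIso.apply_symm_apply] at this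
    exact Or.inr ⟨congrArg _ e1, congrArg _ e2⟩

/-- `p` is the pair of indices of some labeled path with the broadcast messages `B`. -/
def IsIndexPair (N : ℕ → ℕ) (d : ℕ) (B : Inbox) (p : ℕ × ℕ) : Prop :=
  ∃ (X : LabeledGraph) (ident : X.V → ℕ) (n : ℕ) (x y : Fin n → Bool) (i j : Fin n)
    (φ : pathGraph (2 * n + 1) ≃g X.graph), ValidIds N X ident ∧ 2 ≤ n ∧ x j ≠ y i ∧
    IsXorIndexPath X x y i j φ ∧ broadcastInbox d X ident = B ∧ p = (↑i, ↑j)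

/-- The pair of indices found in the broadcast messages. -/
noncomputable def indexPair (N : ℕ → ℕ) (d : ℕ) (B : Inbox) : ℕ × ℕ :=
  Classical.epsilon (IsIndexPair N d B)

/-- The bits of the own label at the two indices. -/
noncomputable def indexedBits (N : ℕ → ℕ) (d : ℕ) (l : BitString) (B : Inbox) : BitString :=
  -- The pair is chosen from `B` only, hence is common to all nodes, but the path may be read in
  -- either direction; both bits are sent because the order is undetermined. The indices count from
  -- `0`, and the default covers labels that are too short.
  [l.getD (indexPair N d B).1 false, l.getD (indexPair N d B).2 false]

open Classical in
/-- The inbox of `v` after its neighbors sent the bits of their labels at the two indices. -/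
noncomputable def indexedBitsInbox (N : ℕ → ℕ) (d : ℕ) (X : LabeledGraph) (ident : X.V → ℕ)
    (v : X.V) : Inbox :=
  (univ.filter fun u => X.graph.Adj v u).image
    fun u => (ident u, indexedBits N d (X.label u) (broadcastInbox d X ident))

open Classical in
/-- All nodes broadcast their neighbors and short labels, then each node sends the bits of its label
at the two indices to its neighbors; a node accepts if its view occurs in the language. -/
noncomputable def xorIndexAlgorithm (N : ℕ → ℕ) (d : ℕ) : Algorithm where
  broadcast I _ := pathBroadcast d I
  send I h _ := indexedBits N d I.label (h.headD ∅)
  accept I h := decide (∃ (X : LabeledGraph) (ident : X.V → ℕ) (v : X.V), ValidIds N X ident ∧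
    X ∈ xorIndexPath ∧ X.localInput ident v = I ∧
    [broadcastInbox d X ident, indexedBitsInbox N d X ident v] = h)

lemma xorIndexAlgorithm_hasBandwidth (N : ℕ → ℕ) (d : ℕ) :
    (xorIndexAlgorithm N d).HasBandwidth (summaryConst d) := by
  refine fun I h => ⟨List.length_take_le _ _, fun k => ?_⟩
  simp only [xorIndexAlgorithm, indexedBits, List.length_cons, List.length_nil, summaryConst]
  nlinarith [Nat.zero_le (Nat.log 2 I.order), Nat.zero_le (d * Nat.log 2 I.order)]

lemma xorIndexAlgorithm_run (N : ℕ → ℕ) (d : ℕ) (X : LabeledGraph) (ident : X.V → ℕ) (v : X.V) :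
    (xorIndexAlgorithm N d).run X ident scheduleBC (fun _ => []) v =
      [broadcastInbox d X ident, indexedBitsInbox N d X ident v] := rfl

/-- If `v` and `v'` receive the same bits, their neighbors `u` and `u'` with the same identifier
hold the same bits at the indices. -/
lemma indexedBits_eq_of_inbox_eq {N : ℕ → ℕ} {d : ℕ} {X X' : LabeledGraph} {ident : X.V → ℕ}
    {ident' : X'.V → ℕ} (hX' : ValidIds N X' ident') {v : X.V} {v' : X'.V}
    (hB : broadcastInbox d X' ident' = broadcastInbox d X ident)
    (h : indexedBitsInbox N d X' ident' v' = indexedBitsInbox N d X ident v) {u : X.V} {u' : X'.V}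
    (hvu : X.graph.Adj v u) (hu : ident' u' = ident u) :
    indexedBits N d (X'.label u') (broadcastInbox d X ident) =
      indexedBits N d (X.label u) (broadcastInbox d X ident) := by
  classical
  have hmem : (ident u, indexedBits N d (X.label u) (broadcastInbox d X ident)) ∈
      indexedBitsInbox N d X ident v :=
    Finset.mem_image_of_mem _ (mem_filter.mpr ⟨mem_univ u, hvu⟩)
  rw [← h] at hmem
  obtain ⟨w, -, hw⟩ := Finset.mem_image.mp hmem
  rw [Prod.mk.injEq, hB] at hw
  have : w = u' := hX'.1 (hw.1.trans hu.symm)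
  rw [← this]
  exact hw.2

lemma getD_ofFn {n : ℕ} (x : Fin n → Bool) (k : Fin n) : (List.ofFn x).getD k false = x k := by
  simp

/-- Strings with the same indexed bits agree at both indices of the path. -/
lemma apply_eq_of_indexedBits_eq {N : ℕ → ℕ} {d : ℕ} (hN : ∀ n, N n ≤ n ^ d + d)
    {X : LabeledGraph} {ident : X.V → ℕ} (hX : ValidIds N X ident) {n : ℕ} (hn : 2 ≤ n)
    {φ : pathGraph (2 * n + 1) ≃g X.graph} {i j : Fin n}
    (hi : X.label (φ (pathNode n 0 (by omega))) = Nat.bits (i + 1))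
    (hj : X.label (φ (pathNode n (2 * n) (by omega))) = Nat.bits (j + 1))
    (hex : ∃ p, IsIndexPair N d (broadcastInbox d X ident) p) {x x' : Fin n → Bool}
    (h : indexedBits N d (List.ofFn x) (broadcastInbox d X ident) =
      indexedBits N d (List.ofFn x') (broadcastInbox d X ident)) :
    x i = x' i ∧ x j = x' j := by
  -- The chosen pair comes from some instance `Z` with the same broadcasts, so it is `(i, j)` or
  -- `(j, i)`.
  obtain ⟨Z, identZ, m, z, w, i', j', ψ, hZ, hm, hzw, hψ, hB, hp⟩ := Classical.epsilon_spec hex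
  have hL : Z ∈ xorIndexPath := ⟨m, z, w, i', j', hm, hzw, ψ, hψ⟩
  obtain ⟨-, e, -, x1, y1, i1, j1, -, he, hi1, hj1⟩ :=
    exists_params_of_broadcastInbox_eq hN hX hZ hL φ hB.symm
  have ei : i1 = i := natBits_succ_inj (hi1.symm.trans hi)
  have ej : j1 = j := natBits_succ_inj (hj1.symm.trans hj)
  subst ei ej
  have hpair : indexPair N d (broadcastInbox d X ident) = (↑i', ↑j') := hp
  unfold indexedBits at h
  rw [hpair] at h
  simp only [List.cons.injEq, and_true] at h
  rcases he.index_eq hn hψ with ⟨e1, e2⟩ | ⟨e1, e2⟩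
  · rw [e1, e2, getD_ofFn, getD_ofFn, getD_ofFn, getD_ofFn] at h
    exact h
  · rw [e1, e2, getD_ofFn, getD_ofFn, getD_ofFn, getD_ofFn] at h
    exact h.symm

/-- A labeled graph in which every node has a view that occurs in the language is in the
language. -/
lemma mem_xorIndexPath_of_forall_view {N : ℕ → ℕ} {d : ℕ} (hN : ∀ n, N n ≤ n ^ d + d)
    {X : LabeledGraph} {ident : X.V → ℕ} (hX : ValidIds N X ident)
    (h : ∀ v, ∃ (X' : LabeledGraph) (ident' : X'.V → ℕ) (v' : X'.V), ValidIds N X' ident' ∧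
      X' ∈ xorIndexPath ∧ X'.localInput ident' v' = X.localInput ident v ∧
      broadcastInbox d X' ident' = broadcastInbox d X ident ∧
      indexedBitsInbox N d X' ident' v' = indexedBitsInbox N d X ident v) :
    X ∈ xorIndexPath := by
  -- Each node checks its own degree, so no summary was truncated and the broadcasts determine the
  -- graph.
  have hdeg : ∀ v, (X.localInput ident v).nbrs.card ≤ 2 := by
    intro v
    obtain ⟨X', ident', v', -, ⟨m, x, y, i, j, hm, hxy, ψ, hψ⟩, hI, -⟩ := h v
    rw [← hI]
    exact card_nbrs_le_two ident' ψ v'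
  obtain ⟨n, ⟨φ⟩⟩ : ∃ n, Nonempty (pathGraph (2 * n + 1) ≃g X.graph) := by
    obtain ⟨v0⟩ := X.nonemptyV
    obtain ⟨X', ident', v', hX', ⟨n, x, y, i, j, hm, hxy, ψ, hψ⟩, -, hB, -⟩ := h v0
    obtain ⟨e, -⟩ :=
      exists_iso_of_broadcastInbox_eq hN hX hX' hdeg (card_nbrs_le_two ident' ψ) hB.symm
    exact ⟨n, ⟨ψ.trans e.symm⟩⟩
  have hview : ∀ v, 2 ≤ n ∧ ∃ (X' : LabeledGraph) (ident' : X'.V → ℕ) (e : X.graph ≃g X'.graph)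
      (x y : Fin n → Bool) (i j : Fin n), ValidIds N X' ident' ∧ (∀ u, ident' (e u) = ident u) ∧
      x j ≠ y i ∧ IsXorIndexPath X' x y i j (φ.trans e) ∧
      X.label (φ (pathNode n 0 (by omega))) = Nat.bits (i + 1) ∧
      X.label (φ (pathNode n (2 * n) (by omega))) = Nat.bits (j + 1) ∧
      X'.label (e v) = X.label v ∧ broadcastInbox d X' ident' = broadcastInbox d X ident ∧
      indexedBitsInbox N d X' ident' (e v) = indexedBitsInbox N d X ident v := by
    intro v
    obtain ⟨X', ident', v', hX', hL, hI, hB, hS⟩ := h v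
    obtain ⟨hn, e, he, x, y, i, j, hxy, hl, hi, hj⟩ :=
      exists_params_of_broadcastInbox_eq hN hX hX' hL φ hB.symm
    have hv : v' = e v := hX'.1 ((congrArg LocalInput.ident hI).trans (he v).symm)
    subst hv
    exact ⟨hn, X', ident', e, x, y, i, j, hX', he, hxy, hl, hi, hj,
      congrArg LocalInput.label hI, hB, hS⟩
  -- The view of the center yields an instance `Y` of the language whose strings agree with those of
  -- `X` at the positions that matter.
  obtain ⟨hn, Y, identY, e, x', y', i, j, hY, he, hxy, hl, hi, hj, -, hB, hS⟩ :=
    hview (φ (pathNode n n (by omega)))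
  -- Different views may come from instances with different strings, but the end labels of `X` force
  -- the same `i` and `j`.
  have hlabel : ∀ k, ∃ x y : Fin n → Bool, X.label (φ k) = xorIndexLabel x y i j k := by
    intro k
    obtain ⟨-, Z, identZ, eZ, x, y, i', j', -, -, -, hlZ, hi', hj', hv, -, -⟩ := hview (φ k)
    have ei : i' = i := natBits_succ_inj (hi'.symm.trans hi)
    have ej : j' = j := natBits_succ_inj (hj'.symm.trans hj)
    subst ei ej
    exact ⟨x, y, hv.symm.trans (hlZ k)⟩
  obtain ⟨x, _, hx⟩ := hlabel (pathNode n (n - 1) (by omega))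
  obtain ⟨_, y, hy⟩ := hlabel (pathNode n (n + 1) (by omega))
  have hx' := hx.trans (xorIndexLabel_left hn _ _ _ _)
  have hy' := hy.trans (xorIndexLabel_right _ _ _ _)
  have hYx := (hl (pathNode n (n - 1) (by omega))).trans (xorIndexLabel_left hn _ _ _ _)
  have hYy := (hl (pathNode n (n + 1) (by omega))).trans (xorIndexLabel_right _ _ _ _)
  have hpair : ∃ p, IsIndexPair N d (broadcastInbox d X ident) p :=
    ⟨_, Y, identY, n, x', y', i, j, φ.trans e, hY, hn, hxy, hl, hB, rfl⟩
  have adjx : X.graph.Adj (φ (pathNode n n (by omega))) (φ (pathNode n (n - 1) (by omega))) := by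
    rw [φ.map_adj_iff, pathGraph_adj]
    exact Or.inr (Nat.sub_add_cancel (by omega))
  have adjy : X.graph.Adj (φ (pathNode n n (by omega))) (φ (pathNode n (n + 1) (by omega))) := by
    rw [φ.map_adj_iff, pathGraph_adj]
    exact Or.inl rfl
  have bx := indexedBits_eq_of_inbox_eq hY hB hS adjx (he _)
  have bys := indexedBits_eq_of_inbox_eq hY hB hS adjy (he _)
  rw [RelIso.trans_apply] at hYx hYy
  rw [hYx, hx'] at bx
  rw [hYy, hy'] at bys
  have ex := (apply_eq_of_indexedBits_eq hN hX hn hi hj hpair bx).2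
  have ey := (apply_eq_of_indexedBits_eq hN hX hn hi hj hpair bys).1
  refine ⟨n, x, y, i, j, hn, by rwa [← ex, ← ey], φ, fun k => ?_⟩
  by_cases k0 : (k : ℕ) = 0
  · have : k = pathNode n 0 (by omega) := Fin.ext k0
    rw [k0, xorIndexLabel_zero, this]
    exact hi
  by_cases k1 : (k : ℕ) + 1 = n
  · have hk : (k : ℕ) = n - 1 := by omega
    have : k = pathNode n (n - 1) (by omega) := Fin.ext hk
    rw [hk, xorIndexLabel_left hn, this]
    exact hx'
  by_cases k2 : (k : ℕ) = n + 1
  · have : k = pathNode n (n + 1) (by omega) := Fin.ext k2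
    rw [k2, xorIndexLabel_right, this]
    exact hy'
  by_cases k3 : (k : ℕ) = 2 * n
  · have : k = pathNode n (2 * n) (by omega) := Fin.ext k3
    rw [k3, xorIndexLabel_last hn, this]
    exact hj
  obtain ⟨xk, yk, hk⟩ := hlabel k
  rw [hk, xorIndexLabel_other _ _ _ _ k0 k1 k2 k3, xorIndexLabel_other _ _ _ _ k0 k1 k2 k3]

theorem xorIndexPath_mem_decisionClass_bcc_congest {N : ℕ → ℕ}
    (hpoly : ∃ d : ℕ, ∀ n, N n ≤ n ^ d + d) : xorIndexPath ∈ DecisionClass N scheduleBC := by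
  obtain ⟨d, hd⟩ := hpoly
  refine ⟨xorIndexAlgorithm N d, summaryConst d, xorIndexAlgorithm_hasBandwidth N d,
    fun X ident hX => ?_⟩
  have hacc : ∀ v, (xorIndexAlgorithm N d).accept (X.localInput ident v)
      ((xorIndexAlgorithm N d).run X ident scheduleBC (fun _ => []) v) = true ↔
      ∃ (X' : LabeledGraph) (ident' : X'.V → ℕ) (v' : X'.V), ValidIds N X' ident' ∧
        X' ∈ xorIndexPath ∧ X'.localInput ident' v' = X.localInput ident v ∧
        [broadcastInbox d X' ident', indexedBitsInbox N d X' ident' v'] =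
          [broadcastInbox d X ident, indexedBitsInbox N d X ident v] := by
    intro v
    rw [xorIndexAlgorithm_run]
    simp only [xorIndexAlgorithm, decide_eq_true_eq]
  constructor
  · exact fun hL v => (hacc v).mpr ⟨X, ident, v, hX, hL, rfl, rfl⟩
  · intro hA
    refine mem_xorIndexPath_of_forall_view hd hX fun v => ?_
    obtain ⟨X', ident', v', h1, h2, h3, h4⟩ := (hacc v).mp (hA v)
    simp only [List.cons.injEq, and_true] at h4
    exact ⟨X', ident', v', h1, h2, h3, h4⟩

end HybridModels

/-! ### Membership, lower bounds and incomparability -/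

theorem mainTheorem4 (N : ℕ → ℕ) (hN : ∀ n, n ≤ N n) (hpoly : ∃ d : ℕ, ∀ n, N n ≤ n ^ d + d) :
    HybridModels.xorIndexPath ∈
        HybridModels.DecisionClass N HybridModels.scheduleBC ∧
      HybridModels.xorIndexPath ∉
        HybridModels.DecisionClass N HybridModels.scheduleCB ∧
      (∀ ε : ℝ, ε < 1 / 5 → HybridModels.xorIndexPath ∉
        HybridModels.RandomizedDecisionClass N HybridModels.scheduleCB ε) ∧
      ¬ HybridModels.DecisionClass N HybridModels.scheduleBC ⊆
        HybridModels.DecisionClass N HybridModels.scheduleCB ∧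
      ¬ HybridModels.DecisionClass N HybridModels.scheduleCB ⊆
        HybridModels.DecisionClass N HybridModels.scheduleBC := by
  have hBC := HybridModels.xorIndexPath_mem_decisionClass_bcc_congest hpoly
  have hCB : HybridModels.xorIndexPath ∉
      HybridModels.DecisionClass N HybridModels.scheduleCB := fun h =>
    HybridModels.xorIndexPath_not_mem_randomizedDecisionClass_congest_bcc hN (by norm_num)
      (HybridModels.decisionClass_subset_randomizedDecisionClass N _ h)
  refine ⟨hBC, hCB, fun ε hε =>
    HybridModels.xorIndexPath_not_mem_randomizedDecisionClass_congest_bcc hN hε,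
    fun h => hCB (h hBC), fun h => ?_⟩
  exact HybridModels.neighborIndexParity_not_mem_randomizedDecisionClass_bcc_congest hN
    (by norm_num) (HybridModels.decisionClass_subset_randomizedDecisionClass N _
      (h (HybridModels.neighborIndexParity_mem_decisionClass N)))
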